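/- Let $\mathbb{B}_n=\{z\in\mathbb{C}^n:|z|<1\}$ ($|\cdot|$ the Euclidean norm), let $\mathbf{b}\in\mathbb{C}^n\setminus\{0\}$ and $\beta>1$, and for $z\in\mathbb{C}^n$ put $S_z=\{t\in\mathbb{C}: z+t\mathbf{b}\in\mathbb{B}_n\}$. Let $\frac{\partial F}{\partial\mathbf{b}}=\sum_{j=1}^n\frac{\partial F}{\partial z_j}b_j$, $\frac{\partial^0F}{\partial\mathbf{b}^0}=F$, and $\frac{\partial^kF}{\partial\mathbf{b}^k}=\frac{\partial}{\partial\mathbf{b}}\Big(\frac{\partial^{k-1}F}{\partial\mathbf{b}^{k-1}}\Big)$. *The class $Q_{\mathbf{b},\beta}(\mathbb{B}_n)$* consists of the continuous functions $L:\mathbb{B}_n\to(0,\infty)$ with $L(z)>\frac{\beta|\mathbf{b}|}{1-|z|}$ for all $z\in\mathbb{B}_n$ and $0<\lambda_1^{\mathbf{b}}(\eta)\le\lambda_2^{\mathbf{b}}(\eta)<\infty$ for all $\eta\in[0,\beta]$, where $\lambda_1^{\mathbf{b}}(\eta)$ and $\lambda_2^{\mathbf{b}}(\eta)$ are the infimum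 and the supremum of $$\frac{L(z+t\mathbf{b})}{L(z+t_0\mathbf{b})}\quad\text{over } z\in\mathbb{B}_n,\ t_0\in S_z,\ t\in\mathbb{C},\ |t-t_0|\le\frac{\eta}{L(z+t_0\mathbf{b})}.$$ *Bounded index.* A function $F$ analytic in $\mathbb{B}_n$ is of bounded $L$-index in the direction $\mathbf{b}$ if there is $m_0\in\mathbb{Z}_{\ge0}$ such that for all $m\in\mathbb{Z}_{\ge0}$ and $z\in\mathbb{B}_n$ $$\frac{1}{m!\,L^m(z)}\left|\frac{\partial^mF(z)}{\partial\mathbf{b}^m}\right|\le\max_{0\le k\le m_0}\frac{1}{k!\,L^k(z)}\left|\frac{\partial^kF(z)}{\partial\mathbf{b}^k}\right|.$$ *Neighbourhoods of zeros.* For $F$ analytic in $\mathbb{B}_n$, $z^0\in\mathbb{B}_n$ and $r>0$, let $G_r^{\mathbf{b}}(F,z^0)=\{z^0+t\mathbf{b}:t\in S_{z^0}\}$ if $F(z^0+t\mathbf{b})=0$ for all $t\in S_{z^0}$, and otherwise $$G_r^{\mathbf{b}}(F,z^0)=\bigcup_{a\in S_{z^0},\,F(z^0+a\mathbf{b})=0}\Big\{z^0+t\mathbf{b}:|t-a|\le\frac{r}{L(z^0+a\mathbf{b})}\Big\}$$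 (empty if there are no zeros). Let $G_r^{\mathbf{b}}(F)=\bigcup_{z^0\in\mathbb{B}_n}G_r^{\mathbf{b}}(F,z^0)$. **Theorem 13.** Let $\beta>1$, $L\in Q_{\mathbf{b},\beta}(\mathbb{B}_n)$, and let $p\ge0$ be an integer. Let $g_0,\dots,g_p,h$ be analytic in $\mathbb{B}_n$ and of bounded $L$-index in the direction $\mathbf{b}$, let $\mathbb{B}_n\setminus G_\beta^{\mathbf{b}}(g_0)\ne\emptyset$, and suppose that for every $r\in(0,\beta]$ there is $T=T(r)>0$ such that for all $z\in\mathbb{B}_n\setminus G_r^{\mathbf{b}}(g_0)$ and $j=1,\dots,p$ $$|g_j(z)|\le T\,L^j(z)\,|g_0(z)|.$$ Then every function $F$ analytic in $\mathbb{B}_n$ that satisfies $$g_0(z)\frac{\partial^pF}{\partial\mathbf{b}^p}+g_1(z)\frac{\partial^{p-1}F}{\partial\mathbf{b}^{p-1}}+\dots+g_p(z)F=h(z)\qquad(z\in\mathbb{B}_n)$$ is of bounded $L$-index in the direction $\mathbf{b}$. -/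

import Mathlib

open scoped ENNReal Nat

noncomputable section

namespace LIndex

/-- The space `ℂⁿ` with its Euclidean norm. -/
abbrev Cn (n : ℕ) : Type := EuclideanSpace ℂ (Fin n)

/-- The open unit ball `𝔹ₙ` of `ℂⁿ`. -/
abbrev unitBall (n : ℕ) : Set (Cn n) := Metric.ball 0 1

variable {n : ℕ}

/-- `S_z`, the set of parameters `t ∈ ℂ` with `z + t b ∈ 𝔹ₙ`. -/
def sliceParam (b z : Cn n) : Set ℂ := {t : ℂ | z + t • b ∈ unitBall n}

/-- The iterated directional derivative `∂ᵏF/∂bᵏ`: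
`∂⁰F/∂b⁰ = F` and `∂ᵏF/∂bᵏ = ∂/∂b (∂ᵏ⁻¹F/∂bᵏ⁻¹)`. -/
def dirDeriv (b : Cn n) : ℕ → (Cn n → ℂ) → Cn n → ℂ
  | 0, F => F
  | k + 1, F => fun z => lineDeriv ℂ (dirDeriv b k F) z b

/-- The quantity `|∂ᵏF(z)/∂bᵏ| / (k! L(z)ᵏ)`. -/
def normalizedDeriv (L : Cn n → ℝ) (b : Cn n) (F : Cn n → ℂ) (k : ℕ) (z : Cn n) : ℝ :=
  ‖dirDeriv b k F z‖ / ((k ! : ℝ) * L z ^ k)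

/-- `F` is analytic in `𝔹ₙ` and of bounded `L`-index in the direction `b`. -/
def IsOfBoundedIndex (L : Cn n → ℝ) (b : Cn n) (F : Cn n → ℂ) : Prop :=
  AnalyticOnNhd ℂ F (unitBall n) ∧
    ∃ m₀ : ℕ, ∀ m : ℕ, ∀ z ∈ unitBall n,
      normalizedDeriv L b F m z ≤
        (Finset.range (m₀ + 1)).sup' Finset.nonempty_range_add_one
          (fun k => normalizedDeriv L b F k z)

/-- `λ₁ᵇ(z, t₀, η, L) = inf { L(z + t b) / L(z + t₀ b) : |t - t₀| ≤ η / L(z + t₀ b) }`,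
as an extended nonnegative real. -/
def lambda₁At (L : Cn n → ℝ) (b : Cn n) (η : ℝ) (z : Cn n) (t₀ : ℂ) : ℝ≥0∞ :=
  ⨅ t ∈ Metric.closedBall t₀ (η / L (z + t₀ • b)),
    ENNReal.ofReal (L (z + t • b) / L (z + t₀ • b))

/-- `λ₂ᵇ(z, t₀, η, L) = sup { L(z + t b) / L(z + t₀ b) : |t - t₀| ≤ η / L(z + t₀ b) }`,
as an extended nonnegative real. -/
def lambda₂At (L : Cn n → ℝ) (b : Cn n) (η : ℝ) (z : Cn n) (t₀ : ℂ) : ℝ≥0∞ :=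
  ⨆ t ∈ Metric.closedBall t₀ (η / L (z + t₀ • b)),
    ENNReal.ofReal (L (z + t • b) / L (z + t₀ • b))

/-- `λ₁ᵇ(η, L)`, the infimum of `λ₁ᵇ(z, t₀, η, L)` over `z ∈ 𝔹ₙ`, `t₀ ∈ S_z`. -/
def lambda₁ (L : Cn n → ℝ) (b : Cn n) (η : ℝ) : ℝ≥0∞ :=
  ⨅ z ∈ unitBall n, ⨅ t₀ ∈ sliceParam b z, lambda₁At L b η z t₀

/-- `λ₂ᵇ(η, L)`, the supremum of `λ₂ᵇ(z, t₀, η, L)` over `z ∈ 𝔹ₙ`, `t₀ ∈ S_z`. -/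
def lambda₂ (L : Cn n → ℝ) (b : Cn n) (η : ℝ) : ℝ≥0∞ :=
  ⨆ z ∈ unitBall n, ⨆ t₀ ∈ sliceParam b z, lambda₂At L b η z t₀

/-- The class `Q_{b,β}(𝔹ₙ)`: positive continuous functions `L` on `𝔹ₙ` with
`L(z) > β|b| / (1 - |z|)` and `0 < λ₁ᵇ(η, L) ≤ λ₂ᵇ(η, L) < ∞` for all `η ∈ [0, β]`.
Only the values of `L` on `𝔹ₙ` matter. -/
structure ClassQ (b : Cn n) (β : ℝ) (L : Cn n → ℝ) : Prop where
  continuousOn : ContinuousOn L (unitBall n)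
  pos : ∀ z ∈ unitBall n, 0 < L z
  lower_bound : ∀ z ∈ unitBall n, β * ‖b‖ / (1 - ‖z‖) < L z
  lambda_bounds : ∀ η ∈ Set.Icc (0 : ℝ) β,
    0 < lambda₁ L b η ∧ lambda₁ L b η ≤ lambda₂ L b η ∧ lambda₂ L b η < ∞

/-- `G_rᵇ(F, z⁰)`: the whole slice through `z⁰` if `F` vanishes identically on it; otherwise the
union, over the zeros `a ∈ S_{z⁰}` of `t ↦ F(z⁰ + t b)`, of the sets
`{z⁰ + t b : |t - a| ≤ r / L(z⁰ + a b)}` (which is empty if there are no zeros). -/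
def zeroNhdSlice (L : Cn n → ℝ) (b : Cn n) (F : Cn n → ℂ) (r : ℝ) (z₀ : Cn n) : Set (Cn n) :=
  {w | ((∀ t ∈ sliceParam b z₀, F (z₀ + t • b) = 0) ∧
          ∃ t ∈ sliceParam b z₀, w = z₀ + t • b) ∨
       ((¬ ∀ t ∈ sliceParam b z₀, F (z₀ + t • b) = 0) ∧
          ∃ a ∈ sliceParam b z₀, F (z₀ + a • b) = 0 ∧
            ∃ t : ℂ, ‖t - a‖ ≤ r / L (z₀ + a • b) ∧ w = z₀ + t • b)}

/-- `G_rᵇ(F)`, the union of the sets `G_rᵇ(F, z⁰)` over `z⁰ ∈ 𝔹ₙ`. -/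
def zeroNhd (L : Cn n → ℝ) (b : Cn n) (F : Cn n → ℂ) (r : ℝ) : Set (Cn n) :=
  ⋃ z₀ ∈ unitBall n, zeroNhdSlice L b F r z₀

end LIndex

end

noncomputable section

namespace LIndex

open Metric Set Filter Topology

variable {n : ℕ}

/-- The absolute value of the `k`-th Taylor coefficient of `f` at the origin. -/
def taylorAbs (f : ℂ → ℂ) (k : ℕ) : ℝ := ‖iteratedDeriv k f 0‖ / (k ! : ℝ)

lemma taylorAbs_nonneg (f : ℂ → ℂ) (k : ℕ) : 0 ≤ taylorAbs f k := by
  unfold taylorAbs; positivity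

lemma taylorAbs_zero (f : ℂ → ℂ) : taylorAbs f 0 = ‖f 0‖ := by
  simp [taylorAbs]

lemma norm_taylor_term (f : ℂ → ℂ) (k : ℕ) (s : ℂ) :
    ‖(k ! : ℂ)⁻¹ • (s - 0) ^ k • iteratedDeriv k f 0‖ = taylorAbs f k * ‖s‖ ^ k := by
  simp only [taylorAbs, sub_zero, norm_smul, norm_inv, norm_pow, RCLike.norm_natCast]
  field_simp

lemma norm_sub_taylor_le {f : ℂ → ℂ} (hf : DifferentiableOn ℂ f (ball 0 1)) {μ : ℝ}
    (hμ : ∀ k, taylorAbs f k ≤ μ) {s : ℂ} (hs : ‖s‖ ≤ 1 / 2) (m : ℕ) :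
    ‖f s - ∑ k ∈ Finset.range m, (k ! : ℂ)⁻¹ • (s - 0) ^ k • iteratedDeriv k f 0‖
      ≤ 2 * μ * ‖s‖ ^ m := by
  have hμ0 : 0 ≤ μ := (taylorAbs_nonneg f 0).trans (hμ 0)
  have hsum := Complex.hasSum_taylorSeries_on_ball hf
    (z := s) (by rw [mem_ball_zero_iff]; linarith)
  have htail := (hasSum_nat_add_iff' m).2 hsum
  have hgeo : HasSum (fun j : ℕ => μ * ‖s‖ ^ m * ‖s‖ ^ j) (μ * ‖s‖ ^ m * (1 - ‖s‖)⁻¹) :=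
    (hasSum_geometric_of_lt_one (norm_nonneg s) (by linarith)).mul_left _
  refine (htail.norm_le_of_bounded hgeo fun j => ?_).trans ?_
  · rw [norm_taylor_term, pow_add]
    have := hμ (j + m)
    have h2 : 0 ≤ ‖s‖ ^ j * ‖s‖ ^ m := by positivity
    nlinarith [mul_le_mul_of_nonneg_right this h2]
  · have : (1 - ‖s‖)⁻¹ ≤ 2 := by
      rw [inv_le_comm₀ (by linarith) (by norm_num)]; linarith
    have h2 : 0 ≤ μ * ‖s‖ ^ m := by positivity
    nlinarith [mul_le_mul_of_nonneg_left this h2]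

lemma norm_le_two_mul_of_taylorAbs_le {f : ℂ → ℂ} (hf : DifferentiableOn ℂ f (ball 0 1)) {μ : ℝ}
    (hμ : ∀ k, taylorAbs f k ≤ μ) {s : ℂ} (hs : ‖s‖ ≤ 1 / 2) : ‖f s‖ ≤ 2 * μ := by
  simpa using norm_sub_taylor_le hf hμ hs 0

/-- The minimum modulus principle on a disc. -/
lemma le_norm_center_of_le_norm_sphere {f : ℂ → ℂ} {ρ c : ℝ} (hρ : 0 < ρ) (hc : 0 < c)
    (hf : DiffContOnCl ℂ f (ball 0 ρ)) (hne : ∀ s ∈ closedBall (0 : ℂ) ρ, f s ≠ 0)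
    (hle : ∀ s ∈ sphere (0 : ℂ) ρ, c ≤ ‖f s‖) : c ≤ ‖f 0‖ := by
  have hinv : DiffContOnCl ℂ f⁻¹ (ball 0 ρ) :=
    hf.inv (by rwa [closure_ball _ hρ.ne'])
  have := Complex.norm_le_of_forall_mem_frontier_norm_le isBounded_ball hinv (C := c⁻¹)
    (fun z hz => by
      rw [frontier_ball _ hρ.ne'] at hz
      rw [Pi.inv_apply, norm_inv]
      exact inv_anti₀ hc (hle z hz))
    (subset_closure (mem_ball_self hρ))
  rw [Pi.inv_apply, norm_inv] at this
  exact (inv_le_inv₀ (norm_pos_iff.2 (hne 0 (mem_closedBall_self hρ.le))) hc).1 this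

/-- A function without zeros near the origin whose Taylor coefficients are dominated by
finitely many of them cannot be small at the origin. -/
lemma exists_le_norm_center (N : ℕ) {r : ℝ} (hr : 0 < r) :
    ∃ c : ℝ, 0 < c ∧ ∀ (f : ℂ → ℂ) (μ : ℝ), DifferentiableOn ℂ f (ball 0 1) →
      (∀ k, taylorAbs f k ≤ μ) → (∃ k ≤ N, μ ≤ taylorAbs f k) →
      (∀ s ∈ closedBall (0 : ℂ) r, f s ≠ 0) → c * μ ≤ ‖f 0‖ := by
  suffices H : ∀ k ≤ N, ∃ η : ℝ, 0 < η ∧ ∀ (f : ℂ → ℂ) (μ : ℝ), DifferentiableOn ℂ f (ball 0 1) →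
      (∀ k, taylorAbs f k ≤ μ) → (∃ k ≤ N, μ ≤ taylorAbs f k) →
      (∀ s ∈ closedBall (0 : ℂ) r, f s ≠ 0) → ∃ j ≤ k, η * μ ≤ taylorAbs f j by
    obtain ⟨η, hη, h⟩ := H 0 (Nat.zero_le N)
    refine ⟨η, hη, fun f μ h1 h2 h3 h4 => ?_⟩
    obtain ⟨j, hj, hj'⟩ := h f μ h1 h2 h3 h4
    obtain rfl : j = 0 := by omega
    rwa [taylorAbs_zero] at hj'
  intro k hk
  induction hk using Nat.decreasingInduction with
  | self => exact ⟨1, one_pos, fun f μ _ _ h3 _ => by simpa using h3⟩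
  | of_succ k hk ih =>
    obtain ⟨η, hη, ih⟩ := ih
    set ρ : ℝ := min r (min (1 / 2) (η / 8)) with hρdef
    have hρ : 0 < ρ := by positivity
    have hρr : ρ ≤ r := min_le_left _ _
    have hρ2 : ρ ≤ 1 / 2 := (min_le_right _ _).trans (min_le_left _ _)
    have hρη : ρ ≤ η / 8 := (min_le_right _ _).trans (min_le_right _ _)
    set η' : ℝ := η * ρ ^ (k + 1) / (4 * (k + 1)) with hη'
    have hη'0 : 0 < η' := by positivity
    have hpow : ρ ^ (k + 1) ≤ 1 := pow_le_one₀ hρ.le (by linarith)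
    have hη'mul : η' * (k + 1) = η * ρ ^ (k + 1) / 4 := by rw [hη']; field_simp
    have hη'le : η' ≤ η * ρ ^ (k + 1) / 4 := by
      rw [← hη'mul]; nlinarith [(Nat.cast_nonneg k : (0 : ℝ) ≤ k)]
    have hη'η : η' ≤ η := by nlinarith
    refine ⟨η', hη'0, fun f μ h1 h2 h3 h4 => ?_⟩
    have hμ0 : 0 ≤ μ := (taylorAbs_nonneg f 0).trans (h2 0)
    obtain ⟨j, hj, hj'⟩ := ih f μ h1 h2 h3 h4
    by_contra! hcon
    have hμ : 0 < μ := by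
      by_contra hμ
      have : μ = 0 := le_antisymm (not_lt.1 hμ) hμ0
      have h0 := hcon 0 (Nat.zero_le k)
      rw [this, mul_zero] at h0
      exact absurd (taylorAbs_nonneg f 0) (not_le.2 h0)
    have hjk : j = k + 1 := by
      by_contra hne
      have := hcon j (by omega)
      nlinarith
    subst hjk
    have hcirc : ∀ s ∈ sphere (0 : ℂ) ρ, η * μ * ρ ^ (k + 1) / 2 ≤ ‖f s‖ := by
      intro s hs
      have hsρ : ‖s‖ = ρ := by simpa using hs
      have ht := norm_sub_taylor_le h1 h2 (hsρ.le.trans hρ2) (k + 2)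
      rw [Finset.sum_range_succ] at ht
      set S := ∑ i ∈ Finset.range (k + 1), (i ! : ℂ)⁻¹ • (s - 0) ^ i • iteratedDeriv i f 0
      set X := ((k + 1)! : ℂ)⁻¹ • (s - 0) ^ (k + 1) • iteratedDeriv (k + 1) f 0
      have hS : ‖S‖ ≤ (k + 1) * (η' * μ) := by
        have hconst : (k + 1) * (η' * μ) = ∑ _i ∈ Finset.range (k + 1), η' * μ := by simp
        rw [hconst]
        refine norm_sum_le_of_le _ fun i hi => ?_
        rw [norm_taylor_term, hsρ]
        have hi' := (hcon i (Nat.lt_succ_iff.1 (Finset.mem_range.1 hi))).le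
        have : ρ ^ i ≤ 1 := pow_le_one₀ hρ.le (by linarith)
        calc taylorAbs f i * ρ ^ i ≤ taylorAbs f i * 1 :=
              mul_le_mul_of_nonneg_left this (taylorAbs_nonneg f i)
          _ ≤ _ := by linarith
      have hX : η * μ * ρ ^ (k + 1) ≤ ‖X‖ := by
        rw [norm_taylor_term, hsρ]
        exact mul_le_mul_of_nonneg_right hj' (by positivity)
      have htail : 2 * μ * ‖s‖ ^ (k + 2) ≤ η * μ * ρ ^ (k + 1) / 4 := by
        rw [hsρ, pow_succ ρ (k + 1)]
        have : 0 ≤ μ * ρ ^ (k + 1) := by positivity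
        nlinarith
      have htri : ‖X‖ ≤ ‖f s‖ + ‖S‖ + ‖f s - (S + X)‖ := by
        calc ‖X‖ = ‖f s - S - (f s - (S + X))‖ := by congr 1; ring
          _ ≤ ‖f s - S‖ + ‖f s - (S + X)‖ := norm_sub_le _ _
          _ ≤ _ := by gcongr; exact norm_sub_le _ _
      have hS' : (k + 1) * (η' * μ) = η * μ * ρ ^ (k + 1) / 4 := by
        rw [show (k + 1) * (η' * μ) = η' * (k + 1) * μ by ring, hη'mul]; ring
      linarith
    have h0 : η * μ * ρ ^ (k + 1) / 2 ≤ ‖f 0‖ := by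
      refine le_norm_center_of_le_norm_sphere hρ (by positivity) ?_ (fun s hs =>
        h4 s (closedBall_subset_closedBall hρr hs)) hcirc
      refine DifferentiableOn.diffContOnCl (h1.mono ?_)
      rw [closure_ball _ hρ.ne']
      exact closedBall_subset_ball (by linarith)
    have h5 := hcon 0 (Nat.zero_le k)
    rw [taylorAbs_zero] at h5
    have : 0 < η * μ * ρ ^ (k + 1) := by positivity
    nlinarith

/-- Repeated division by linear factors: zeros near the origin make the function small. -/
lemma norm_le_of_zeros (A : Finset ℂ) : ∀ (f : ℂ → ℂ) (M : ℝ),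
    DifferentiableOn ℂ f (ball 0 (1 / 2)) → (∀ s ∈ ball (0 : ℂ) (1 / 2), ‖f s‖ ≤ M) →
    (∀ a ∈ A, ‖a‖ ≤ 1 / 10 ∧ f a = 0) → ∀ s : ℂ, ‖s‖ ≤ 1 / 10 → ‖f s‖ ≤ M * (1 / 2) ^ A.card := by
  classical
  induction A using Finset.induction_on with
  | empty =>
    intro f M _ hM _ s hs
    simpa using hM s (by rw [mem_ball_zero_iff]; linarith)
  | insert a A ha ih =>
    intro f M hf hM hA s hs
    obtain ⟨han, hfa⟩ := hA a (Finset.mem_insert_self a A)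
    have hmem : a ∈ ball (0 : ℂ) (1 / 2) := by rw [mem_ball_zero_iff]; linarith
    have hsub : ball a (2 / 5) ⊆ ball (0 : ℂ) (1 / 2) := by
      refine ball_subset_ball' ?_
      rw [dist_zero_right]; linarith
    have hd : DifferentiableOn ℂ (dslope f a) (ball 0 (1 / 2)) :=
      (Complex.differentiableOn_dslope (isOpen_ball.mem_nhds hmem)).2 hf
    have hb : ∀ w ∈ ball (0 : ℂ) (1 / 2), ‖dslope f a w‖ ≤ M / (2 / 5) := by
      intro w hw
      by_cases hwa : w ∈ ball a (2 / 5)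
      · refine Complex.norm_dslope_le_div_of_mapsTo_ball (hf.mono hsub) ?_ hwa
        intro v hv
        rw [hfa, mem_closedBall_zero_iff]
        exact hM v (hsub hv)
      · rw [mem_ball, not_lt, dist_eq_norm] at hwa
        have hne : w ≠ a := by
          rintro rfl
          norm_num at hwa
        rw [dslope_of_ne _ hne, slope_def_field, hfa, sub_zero, norm_div]
        have hM0 : 0 ≤ M := (norm_nonneg _).trans (hM w hw)
        exact div_le_div₀ hM0 (hM w hw) (by norm_num) hwa
    have h := ih (dslope f a) (M / (2 / 5)) hd hb (fun c hc => by
      obtain ⟨h1, h2⟩ := hA c (Finset.mem_insert_of_mem hc)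
      refine ⟨h1, ?_⟩
      have hne : c ≠ a := by rintro rfl; exact ha hc
      rw [dslope_of_ne _ hne, slope_def_field, hfa, h2]; simp) s hs
    have hfs : f s = (s - a) * dslope f a s := by
      have := sub_smul_dslope f a s
      rw [smul_eq_mul, hfa, sub_zero] at this
      exact this.symm
    have hsa : ‖s - a‖ ≤ 1 / 5 := (norm_sub_le _ _).trans (by linarith)
    rw [hfs, norm_mul, Finset.card_insert_of_notMem ha, pow_succ]
    calc ‖s - a‖ * ‖dslope f a s‖ ≤ 1 / 5 * (M / (2 / 5) * (1 / 2) ^ A.card) :=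
          mul_le_mul hsa h (norm_nonneg _) (by norm_num)
      _ = _ := by ring

/-- A function whose Taylor coefficients are dominated by the first `N` of them has a bounded
number of zeros near the origin. -/
lemma two_pow_card_zeros_le {N : ℕ} {f : ℂ → ℂ} {μ : ℝ} (hμ : 0 < μ)
    (hf : DifferentiableOn ℂ f (ball 0 1)) (h2 : ∀ k, taylorAbs f k ≤ μ)
    (h3 : ∃ k ≤ N, μ ≤ taylorAbs f k) (A : Finset ℂ) (hA : ∀ a ∈ A, ‖a‖ ≤ 1 / 10 ∧ f a = 0) :
    (2 : ℝ) ^ A.card ≤ 2 * 10 ^ N := by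
  obtain ⟨k, hkN, hk⟩ := h3
  have hb := norm_le_of_zeros A f (2 * μ) (hf.mono (ball_subset_ball (by norm_num)))
    (fun s hs => norm_le_two_mul_of_taylorAbs_le hf h2 (mem_ball_zero_iff.1 hs).le) hA
  have hd : DiffContOnCl ℂ f (ball 0 (1 / 10)) := by
    refine DifferentiableOn.diffContOnCl (hf.mono ?_)
    rw [closure_ball _ (by norm_num)]
    exact closedBall_subset_ball (by norm_num)
  have hc := Complex.norm_iteratedDeriv_le_of_forall_mem_sphere_norm_le k (by norm_num) hd
    (C := 2 * μ * (1 / 2) ^ A.card) (fun z hz => hb z (mem_sphere_zero_iff_norm.1 hz).le)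
  have hk' : μ ≤ 2 * μ * (1 / 2) ^ A.card * 10 ^ k := by
    refine hk.trans ?_
    rw [taylorAbs, div_le_iff₀ (by positivity)]
    refine hc.trans (le_of_eq ?_)
    rw [one_div (10 : ℝ), inv_pow, div_inv_eq_mul]
    ring
  have h10 : (10 : ℝ) ^ k ≤ 10 ^ N := pow_le_pow_right₀ (by norm_num) hkN
  rw [one_div, inv_pow] at hk'
  have h2p : (0 : ℝ) < 2 ^ A.card := by positivity
  have hk2 : μ * 2 ^ A.card ≤ μ * (2 * 10 ^ k) := by
    have := mul_le_mul_of_nonneg_right hk' h2p.le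
    refine this.trans (le_of_eq ?_)
    field_simp
  have := le_of_mul_le_mul_left hk2 hμ
  linarith

lemma analyticOnNhd_dirDeriv {b : Cn n} {F : Cn n → ℂ} (hF : AnalyticOnNhd ℂ F (unitBall n))
    (k : ℕ) : AnalyticOnNhd ℂ (dirDeriv b k F) (unitBall n) := by
  induction k with
  | zero => exact hF
  | succ k ih =>
    have h : AnalyticOnNhd ℂ (fun z => fderiv ℂ (dirDeriv b k F) z b) (unitBall n) :=
      (ContinuousLinearMap.apply ℂ ℂ b).comp_analyticOnNhd ih.fderiv
    refine h.congr isOpen_ball fun z hz => ?_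
    exact ((ih z hz).differentiableAt.lineDeriv_eq_fderiv).symm

lemma hasDerivAt_dirDeriv_line {b : Cn n} {F : Cn n → ℂ} (hF : AnalyticOnNhd ℂ F (unitBall n))
    (k : ℕ) {z : Cn n} {t : ℂ} (ht : z + t • b ∈ unitBall n) :
    HasDerivAt (fun t : ℂ => dirDeriv b k F (z + t • b)) (dirDeriv b (k + 1) F (z + t • b)) t := by
  have hd := (analyticOnNhd_dirDeriv (b := b) hF k _ ht).differentiableAt
  have h1 : HasDerivAt (fun t : ℂ => z + t • b) b t := by
    simpa using ((hasDerivAt_id t).smul_const b).const_add z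
  have h2 := hd.hasFDerivAt.comp_hasDerivAt t h1
  rw [← hd.lineDeriv_eq_fderiv] at h2
  exact h2

/-- The restriction of `F` to the complex line through `z` in direction `b`, with the parameter
rescaled by `ℓ`. -/
def sliceFun (F : Cn n → ℂ) (b z : Cn n) (ℓ : ℝ) (s : ℂ) : ℂ := F (z + (s / (ℓ : ℂ)) • b)

lemma continuous_slice (b z : Cn n) (ℓ : ℝ) : Continuous fun s : ℂ => z + (s / (ℓ : ℂ)) • b := by
  fun_prop

lemma hasDerivAt_dirDeriv_slice {b : Cn n} {F : Cn n → ℂ} (hF : AnalyticOnNhd ℂ F (unitBall n))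
    (k : ℕ) {z : Cn n} {ℓ : ℝ} {s : ℂ} (hs : z + (s / (ℓ : ℂ)) • b ∈ unitBall n) :
    HasDerivAt (fun s : ℂ => dirDeriv b k F (z + (s / (ℓ : ℂ)) • b))
      (dirDeriv b (k + 1) F (z + (s / (ℓ : ℂ)) • b) / ℓ) s := by
  have h := (hasDerivAt_dirDeriv_line hF k hs).comp s ((hasDerivAt_id s).div_const (ℓ : ℂ))
  simpa [Function.comp_def, div_eq_mul_inv] using h

lemma iteratedDeriv_sliceFun {b : Cn n} {F : Cn n → ℂ} (hF : AnalyticOnNhd ℂ F (unitBall n))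
    (k : ℕ) {z : Cn n} {ℓ : ℝ} {s : ℂ} (hs : z + (s / (ℓ : ℂ)) • b ∈ unitBall n) :
    iteratedDeriv k (sliceFun F b z ℓ) s
      = dirDeriv b k F (z + (s / (ℓ : ℂ)) • b) / (ℓ : ℂ) ^ k := by
  induction k generalizing s with
  | zero => simp [sliceFun, dirDeriv]
  | succ k ih =>
    rw [iteratedDeriv_succ]
    have hev : iteratedDeriv k (sliceFun F b z ℓ) =ᶠ[𝓝 s]
        fun s => dirDeriv b k F (z + (s / (ℓ : ℂ)) • b) / (ℓ : ℂ) ^ k := by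
      filter_upwards [(continuous_slice b z ℓ).continuousAt.preimage_mem_nhds
        (isOpen_ball.mem_nhds hs)] with u hu using ih hu
    rw [hev.deriv_eq, ((hasDerivAt_dirDeriv_slice hF k hs).div_const _).deriv, pow_succ',
      div_div]

lemma differentiableAt_sliceFun {b : Cn n} {F : Cn n → ℂ} (hF : AnalyticOnNhd ℂ F (unitBall n))
    {z : Cn n} {ℓ : ℝ} {s : ℂ} (hs : z + (s / (ℓ : ℂ)) • b ∈ unitBall n) :
    DifferentiableAt ℂ (sliceFun F b z ℓ) s :=
  (hasDerivAt_dirDeriv_slice hF 0 hs).differentiableAt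

lemma taylorAbs_sliceFun {b : Cn n} {F : Cn n → ℂ} (hF : AnalyticOnNhd ℂ F (unitBall n))
    {L : Cn n → ℝ} {z : Cn n} (hz : z ∈ unitBall n) (hL : 0 < L z) (k : ℕ) :
    taylorAbs (sliceFun F b z (L z)) k = normalizedDeriv L b F k z := by
  rw [taylorAbs, iteratedDeriv_sliceFun hF k (by simpa using hz), normalizedDeriv]
  simp only [zero_div, zero_smul, add_zero, norm_div, norm_pow, Complex.norm_real,
    Real.norm_of_nonneg hL.le]
  rw [div_div, mul_comm]

/-- The sequence of normalized derivatives is dominated by its first terms. -/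
lemma exists_isMax_of_le_sup' {a : ℕ → ℝ} {m : ℕ}
    (h : ∀ k, a k ≤ (Finset.range (m + 1)).sup' Finset.nonempty_range_add_one a) :
    ∃ μ, (∀ k, a k ≤ μ) ∧ ∃ k ≤ m, μ ≤ a k := by
  obtain ⟨k, hk, hk'⟩ := Finset.exists_mem_eq_sup' (s := Finset.range (m + 1))
    Finset.nonempty_range_add_one a
  exact ⟨_, h, k, by simpa [Nat.lt_succ_iff] using hk, hk'.le⟩

namespace ClassQ

variable {b : Cn n} {β : ℝ} {L : Cn n → ℝ}

lemma mem_ball_of_norm_le (hL : ClassQ b β L) (hb : b ≠ 0) {z : Cn n} (hz : z ∈ unitBall n) {t : ℂ}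
    (ht : ‖t‖ ≤ β / L z) : z + t • b ∈ unitBall n := by
  have hz1 : ‖z‖ < 1 := by simpa using hz
  have hlb := hL.lower_bound z hz
  rw [div_lt_iff₀ (by linarith)] at hlb
  have hpos := hL.pos z hz
  have hbn : 0 < ‖b‖ := norm_pos_iff.2 hb
  rw [le_div_iff₀ hpos] at ht
  have : ‖t‖ * ‖b‖ < 1 - ‖z‖ := by
    have h1 : L z * (‖t‖ * ‖b‖) < L z * (1 - ‖z‖) := by nlinarith
    exact lt_of_mul_lt_mul_left h1 hpos.le
  rw [mem_ball_zero_iff]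
  calc ‖z + t • b‖ ≤ ‖z‖ + ‖t • b‖ := norm_add_le _ _
    _ < 1 := by rw [norm_smul]; linarith

lemma norm_div_le (hL : ClassQ b β L) {z : Cn n} (hz : z ∈ unitBall n) {s : ℂ} {r : ℝ}
    (hs : ‖s‖ ≤ r) : ‖s / (L z : ℂ)‖ ≤ r / L z := by
  have hpos := hL.pos z hz
  rw [norm_div, Complex.norm_real, Real.norm_of_nonneg hpos.le]
  gcongr

lemma slice_mem_ball (hL : ClassQ b β L) (hb : b ≠ 0) {z : Cn n} (hz : z ∈ unitBall n) {s : ℂ}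
    (hs : ‖s‖ ≤ β) : z + (s / (L z : ℂ)) • b ∈ unitBall n :=
  hL.mem_ball_of_norm_le hb hz (hL.norm_div_le hz hs)

/-- Values of `L` at points of one slice at controlled distance are comparable. -/
lemma exists_comparable (hL : ClassQ b β L) (hb : b ≠ 0) (hβ : 1 < β) :
    ∃ lam : ℝ, 1 ≤ lam ∧ ∀ z ∈ unitBall n, ∀ t : ℂ, ‖t‖ ≤ β / L z →
      L (z + t • b) ≤ lam * L z ∧ L z ≤ lam * L (z + t • b) := by
  obtain ⟨h1, _, h2⟩ := hL.lambda_bounds β ⟨by linarith, le_rfl⟩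
  have hbound : ∀ z ∈ unitBall n, ∀ t : ℂ, ‖t‖ ≤ β / L z →
      lambda₁ L b β ≤ ENNReal.ofReal (L (z + t • b) / L z) ∧
        ENNReal.ofReal (L (z + t • b) / L z) ≤ lambda₂ L b β := by
    intro z hz t ht
    have h0 : (0 : ℂ) ∈ sliceParam b z := by simpa [sliceParam] using hz
    have ht' : t ∈ closedBall (0 : ℂ) (β / L (z + (0 : ℂ) • b)) := by simpa using ht
    constructor
    · refine (iInf₂_le z hz).trans ((iInf₂_le 0 h0).trans ((iInf₂_le t ht').trans ?_))
      simp
    · refine le_trans ?_ (le_iSup₂_of_le z hz (le_iSup₂_of_le 0 h0 (le_iSup₂_of_le t ht' le_rfl)))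
      simp
  set m := (lambda₁ L b β)⁻¹.toReal
  set M := (lambda₂ L b β).toReal
  refine ⟨max 1 (max m M), le_max_left _ _, fun z hz t ht => ?_⟩
  have hz0 := hL.pos z hz
  have hw0 := hL.pos _ (hL.mem_ball_of_norm_le hb hz ht)
  obtain ⟨hlo, hhi⟩ := hbound z hz t ht
  constructor
  · have h := (ENNReal.ofReal_le_iff_le_toReal h2.ne).1 hhi
    rw [div_le_iff₀ hz0] at h
    exact h.trans (by gcongr; exact (le_max_right _ _).trans (le_max_right _ _))
  · have hinv : ENNReal.ofReal (L z / L (z + t • b)) ≤ (lambda₁ L b β)⁻¹ := by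
      rw [← inv_div, ENNReal.ofReal_inv_of_pos (by positivity)]
      exact ENNReal.inv_le_inv.2 hlo
    have h := (ENNReal.ofReal_le_iff_le_toReal (ENNReal.inv_ne_top.2 h1.ne')).1 hinv
    rw [div_le_iff₀ hw0] at h
    exact h.trans (by gcongr; exact (le_max_left _ _).trans (le_max_right _ _))

lemma differentiableOn_sliceFun (hL : ClassQ b β L) (hb : b ≠ 0) {F : Cn n → ℂ}
    (hF : AnalyticOnNhd ℂ F (unitBall n)) {z : Cn n} (hz : z ∈ unitBall n) :
    DifferentiableOn ℂ (sliceFun F b z (L z)) (ball 0 β) := fun _ hs =>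
  (differentiableAt_sliceFun hF
    (hL.slice_mem_ball hb hz (mem_ball_zero_iff.1 hs).le)).differentiableWithinAt

end ClassQ

lemma convex_sliceParam (b z : Cn n) : Convex ℝ (sliceParam b z) := by
  intro s hs t ht α γ hα hγ hαγ
  have h := (convex_ball (0 : Cn n) 1) hs ht hα hγ hαγ
  have heq : z + (α • s + γ • t) • b = α • (z + s • b) + γ • (z + t • b) := by
    have : z = (α + γ) • z := by rw [hαγ, one_smul]
    nth_rewrite 1 [this]
    simp only [add_smul, smul_add, smul_assoc]
    abel
  change z + (α • s + γ • t) • b ∈ unitBall n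
  rw [heq]
  exact h

/-- Identity theorem on a slice. -/
lemma eq_zero_on_slice {b : Cn n} {F : Cn n → ℂ} (hF : AnalyticOnNhd ℂ F (unitBall n))
    {L : Cn n → ℝ} {β : ℝ} (hL : ClassQ b β L) (hb : b ≠ 0) (hβ : 1 < β)
    {w : Cn n} (hw : w ∈ unitBall n) (h0 : ∀ k, normalizedDeriv L b F k w = 0)
    {t : ℂ} (ht : w + t • b ∈ unitBall n) : F (w + t • b) = 0 := by
  have hd := (hL.differentiableOn_sliceFun hb hF hw).mono (ball_subset_ball hβ.le)
  have hLw := hL.pos w hw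
  have hzero : ∀ s ∈ ball (0 : ℂ) (1 / 2), sliceFun F b w (L w) s = 0 := by
    intro s hs
    have := norm_le_two_mul_of_taylorAbs_le (μ := 0) hd
      (fun k => by rw [taylorAbs_sliceFun hF hw hLw, h0 k]) (mem_ball_zero_iff.1 hs).le
    simpa using this
  have hopen : IsOpen (sliceParam b w) := isOpen_ball.preimage (by fun_prop)
  have hana : AnalyticOnNhd ℂ (fun t : ℂ => F (w + t • b)) (sliceParam b w) := by
    refine DifferentiableOn.analyticOnNhd (fun t ht => ?_) hopen
    exact (hasDerivAt_dirDeriv_line hF 0 ht).differentiableAt.differentiableWithinAt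
  refine hana.eqOn_zero_of_preconnected_of_eventuallyEq_zero (z₀ := 0)
    (convex_sliceParam b w).isPreconnected (by simpa [sliceParam] using hw) ?_ ht
  have hr : 0 < 1 / 2 / L w := by positivity
  filter_upwards [ball_mem_nhds (0 : ℂ) hr] with u hu
  have hu' : ‖u‖ * L w < 1 / 2 := by
    rw [mem_ball_zero_iff, lt_div_iff₀ hLw] at hu; exact hu
  have := hzero (u * L w) (by
    rw [mem_ball_zero_iff, norm_mul, Complex.norm_real, Real.norm_of_nonneg hLw.le]; exact hu')
  rw [sliceFun, mul_div_cancel_right₀ _ (by exact_mod_cast hLw.ne')] at this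
  exact this

/-- A function of bounded index has a bounded number of zeros in small discs of those slices on
which it does not vanish identically. -/
lemma exists_card_zeros_near_le {b : Cn n} {F : Cn n → ℂ} {L : Cn n → ℝ} {β : ℝ}
    (hF : IsOfBoundedIndex L b F) (hL : ClassQ b β L) (hb : b ≠ 0) (hβ : 1 < β) :
    ∃ N : ℕ, ∀ w ∈ unitBall n, (∃ t : ℂ, w + t • b ∈ unitBall n ∧ F (w + t • b) ≠ 0) →
      ∀ A : Finset ℂ, (∀ a ∈ A, ‖a‖ ≤ 1 / 10 ∧ sliceFun F b w (L w) a = 0) → A.card ≤ N := by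
  obtain ⟨hFa, m, hm⟩ := hF
  obtain ⟨N, hN⟩ := pow_unbounded_of_one_lt (2 * 10 ^ m : ℝ) one_lt_two
  refine ⟨N, fun w hw ⟨t, ht, hFt⟩ A hA => ?_⟩
  obtain ⟨μ, h1, k, hk, h2⟩ := exists_isMax_of_le_sup' fun k => hm k w hw
  have hLw := hL.pos w hw
  have hμ : 0 < μ := by
    by_contra hμ
    refine hFt (eq_zero_on_slice hFa hL hb hβ hw (fun j => ?_) ht)
    refine le_antisymm ((h1 j).trans (not_lt.1 hμ)) ?_
    rw [← taylorAbs_sliceFun hFa hw hLw]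
    exact taylorAbs_nonneg _ _
  have := two_pow_card_zeros_le hμ
    ((hL.differentiableOn_sliceFun hb hFa hw).mono (ball_subset_ball hβ.le))
    (fun j => by rw [taylorAbs_sliceFun hFa hw hLw]; exact h1 j)
    ⟨k, hk, by rw [taylorAbs_sliceFun hFa hw hLw]; exact h2⟩ A hA
  exact ((pow_lt_pow_iff_right₀ (one_lt_two : (1 : ℝ) < 2)).1 (this.trans_lt hN)).le

/-- Rebasing a slice at another of its points. -/
lemma slice_rebase (b z : Cn n) {ℓ ℓ' : ℝ} (hℓ' : ℓ' ≠ 0) (x a : ℂ) :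
    (z + (x / (ℓ : ℂ)) • b) + (((a - x) * (ℓ' / ℓ : ℝ)) / (ℓ' : ℂ)) • b = z + (a / (ℓ : ℂ)) • b := by
  rw [add_assoc, ← add_smul]
  congr 2
  have : (ℓ' : ℂ) ≠ 0 := by exact_mod_cast hℓ'
  push_cast
  field_simp
  ring

lemma exists_card_zeros_le {b : Cn n} {F : Cn n → ℂ} {L : Cn n → ℝ} {β : ℝ}
    (hF : IsOfBoundedIndex L b F) (hL : ClassQ b β L) (hb : b ≠ 0) (hβ : 1 < β) :
    ∃ N : ℕ, ∀ z ∈ unitBall n, (∃ t : ℂ, z + t • b ∈ unitBall n ∧ F (z + t • b) ≠ 0) →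
      ∀ A : Finset ℂ, (∀ a ∈ A, ‖a‖ ≤ β ∧ sliceFun F b z (L z) a = 0) → A.card ≤ N := by
  classical
  obtain ⟨N, hN⟩ := exists_card_zeros_near_le hF hL hb hβ
  obtain ⟨lam, hlam, hcomp⟩ := hL.exists_comparable hb hβ
  obtain ⟨I, hI, hIfin, hcov⟩ := (isCompact_closedBall (0 : ℂ) β).finite_cover_balls
    (e := 1 / (10 * lam)) (by positivity)
  lift I to Finset ℂ using hIfin
  refine ⟨∑ _x ∈ I, N, fun z hz ⟨t, ht, hFt⟩ A hA => ?_⟩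
  have hLz := hL.pos z hz
  have hsub : A ⊆ I.biUnion fun x => A.filter fun a => dist a x < 1 / (10 * lam) := by
    intro a ha
    obtain ⟨x, hx, hax⟩ := mem_iUnion₂.1 (hcov (mem_closedBall_zero_iff.2 (hA a ha).1))
    exact Finset.mem_biUnion.2 ⟨x, hx, Finset.mem_filter.2 ⟨ha, hax⟩⟩
  refine (Finset.card_le_card hsub).trans (Finset.card_biUnion_le.trans
    (Finset.sum_le_sum fun x hx => ?_))
  have hxβ : ‖x‖ ≤ β := mem_closedBall_zero_iff.1 (hI hx)
  set w := z + (x / (L z : ℂ)) • b with hw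
  have hwB : w ∈ unitBall n := hL.slice_mem_ball hb hz hxβ
  have hLw := hL.pos w hwB
  obtain ⟨hc, -⟩ := hcomp z hz _ (hL.norm_div_le hz hxβ)
  set q : ℝ := L w / L z with hq
  have hq0 : 0 < q := by positivity
  have hqlam : q ≤ lam := by rw [hq, div_le_iff₀ hLz]; exact hc
  have hinj : Function.Injective fun a : ℂ => (a - x) * (q : ℂ) := by
    intro a a' h
    have hqc : (q : ℂ) ≠ 0 := by exact_mod_cast hq0.ne'
    exact sub_left_injective (mul_right_cancel₀ hqc h)
  rw [← Finset.card_image_of_injective _ hinj]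
  refine hN w hwB ⟨t - x / L z, ?_⟩ _ fun σ hσ => ?_
  · have : w + (t - x / L z) • b = z + t • b := by
      rw [hw, add_assoc, ← add_smul]; congr 2; ring
    rw [this]; exact ⟨ht, hFt⟩
  · obtain ⟨a, ha, rfl⟩ := Finset.mem_image.1 hσ
    obtain ⟨haA, hax⟩ := Finset.mem_filter.1 ha
    constructor
    · rw [norm_mul, Complex.norm_real, Real.norm_of_nonneg hq0.le, ← dist_eq_norm]
      calc dist a x * q ≤ 1 / (10 * lam) * lam := by gcongr
        _ = 1 / 10 := by field_simp
    · rw [sliceFun, hw, slice_rebase b z hLw.ne']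
      exact (hA a haA).2

/-- Logarithmic derivative estimate away from the zeros. -/
lemma exists_norm_dirDeriv_one_le {b : Cn n} {F : Cn n → ℂ} {L : Cn n → ℝ} {β : ℝ}
    (hF : IsOfBoundedIndex L b F) (hL : ClassQ b β L) (hb : b ≠ 0) (hβ : 1 < β) {r : ℝ}
    (hr : 0 < r) :
    ∃ K : ℝ, 0 < K ∧ ∀ w ∈ unitBall n, (∀ s : ℂ, ‖s‖ ≤ r → sliceFun F b w (L w) s ≠ 0) →
      ‖dirDeriv b 1 F w‖ ≤ K * L w * ‖F w‖ := by
  obtain ⟨hFa, m, hm⟩ := hF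
  obtain ⟨c, hc, hcle⟩ := exists_le_norm_center m hr
  refine ⟨c⁻¹, by positivity, fun w hw hne => ?_⟩
  obtain ⟨μ, h1, k, hk, h2⟩ := exists_isMax_of_le_sup' fun k => hm k w hw
  have hLw := hL.pos w hw
  have h := hcle (sliceFun F b w (L w)) μ
    ((hL.differentiableOn_sliceFun hb hFa hw).mono (ball_subset_ball hβ.le))
    (fun j => by rw [taylorAbs_sliceFun hFa hw hLw]; exact h1 j)
    ⟨k, hk, by rw [taylorAbs_sliceFun hFa hw hLw]; exact h2⟩
    (fun s hs => hne s (mem_closedBall_zero_iff.1 hs))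
  have hF0 : sliceFun F b w (L w) 0 = F w := by simp [sliceFun]
  rw [hF0] at h
  have h3 := h1 1
  rw [normalizedDeriv, div_le_iff₀ (by positivity)] at h3
  simp only [Nat.factorial_one, Nat.cast_one, pow_one, one_mul] at h3
  have h4 : μ ≤ c⁻¹ * ‖F w‖ := by rw [← div_eq_inv_mul, le_div_iff₀ hc]; linarith
  calc _ ≤ μ * L w := h3
    _ ≤ c⁻¹ * ‖F w‖ * L w := by gcongr
    _ = _ := by ring

lemma notMem_zeroNhd {b : Cn n} {F : Cn n → ℂ} {L : Cn n → ℝ} {β : ℝ} (hL : ClassQ b β L)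
    {lam r : ℝ}
    (hcomp : ∀ z ∈ unitBall n, ∀ t : ℂ, ‖t‖ ≤ β / L z →
      L (z + t • b) ≤ lam * L z ∧ L z ≤ lam * L (z + t • b))
    (hr0 : 0 ≤ r) (hr : r ≤ β) (hlam : 1 ≤ lam) {w : Cn n} (hw : w ∈ unitBall n)
    (hne : ∀ s : ℂ, ‖s‖ ≤ r * lam → sliceFun F b w (L w) s ≠ 0) :
    w ∉ zeroNhd L b F r := by
  have hLw := hL.pos w hw
  intro hmem
  obtain ⟨z, hz, hmem⟩ := mem_iUnion₂.1 hmem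
  rcases hmem with ⟨h0, t, ht, rfl⟩ | ⟨-, a, ha, hFa, t, hta, rfl⟩
  · refine hne 0 (by rw [norm_zero]; positivity) ?_
    simpa [sliceFun] using h0 t ht
  · set P := z + a • b with hP
    have hLP := hL.pos P ha
    have hw' : z + t • b = P + (t - a) • b := by
      rw [hP, add_assoc, ← add_smul]; congr 2; ring
    have hc := (hcomp P ha (t - a) (hta.trans (by gcongr))).1
    rw [← hw'] at hc
    refine hne ((a - t) * L (z + t • b)) ?_ ?_
    · rw [norm_mul, Complex.norm_real, Real.norm_of_nonneg hLw.le, norm_sub_rev]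
      rw [le_div_iff₀ hLP] at hta
      calc ‖t - a‖ * L (z + t • b) ≤ ‖t - a‖ * (lam * L P) := by gcongr
        _ = ‖t - a‖ * L P * lam := by ring
        _ ≤ r * lam := by gcongr
    · rw [sliceFun, mul_div_cancel_right₀ _ (by exact_mod_cast hLw.ne'), add_assoc, ← add_smul]
      simpa [hP] using hFa

/-- A nonnegative sequence whose geometrically growing multiples are controlled by its
geometrically decaying sum is dominated by finitely many of its terms. -/
lemma exists_dominating_initial_segment {B R : ℝ} (hB : 0 < B) (hR : 1 < R) :
    ∃ N : ℕ, ∀ A : ℕ → ℝ, (∀ k, 0 ≤ A k) →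
      (∀ m, A m * R ^ m ≤ B * ∑' k, A k * (1 / 2) ^ k) → ∀ m, ∃ k ≤ N, A m ≤ A k := by
  obtain ⟨m₀, hm₀⟩ := exists_pow_lt_of_lt_one (x := 1 / (4 * B)) (by positivity)
    (one_half_lt_one : (1 / 2 : ℝ) < 1)
  obtain ⟨m₁, hm₁⟩ := pow_unbounded_of_one_lt (4 * B) hR
  refine ⟨max m₀ m₁, fun A hA h m => ?_⟩
  set S := ∑' k, A k * (1 / 2) ^ k with hS
  have hS0 : 0 ≤ S := tsum_nonneg fun k => mul_nonneg (hA k) (by positivity)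
  have hAB : ∀ k, A k ≤ B * S := fun k =>
    (le_mul_of_one_le_right (hA k) (one_le_pow₀ hR.le)).trans (h k)
  have hgeo : HasSum (fun k : ℕ => B * S * (1 / 2) ^ k) (B * S * 2) :=
    hasSum_geometric_two.mul_left _
  have hsum : Summable fun k => A k * (1 / 2 : ℝ) ^ k :=
    Summable.of_nonneg_of_le (fun k => mul_nonneg (hA k) (by positivity))
      (fun k => mul_le_mul_of_nonneg_right (hAB k) (by positivity)) hgeo.summable
  obtain ⟨k, hk, hmax⟩ := Finset.exists_max_image (Finset.range (m₀ + 1)) A ⟨0, by simp⟩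
  have hsplit := hsum.sum_add_tsum_nat_add (m₀ + 1)
  have htail : ∑' j, A (j + (m₀ + 1)) * (1 / 2 : ℝ) ^ (j + (m₀ + 1)) ≤ S / 2 := by
    have h1 : HasSum (fun j : ℕ => (1 / 2 : ℝ) ^ (m₀ + 1) * (B * S * (1 / 2) ^ j))
        ((1 / 2) ^ (m₀ + 1) * (B * S * 2)) := hgeo.mul_left _
    refine (Summable.tsum_le_tsum (fun j => ?_)
      ((summable_nat_add_iff (m₀ + 1)).2 hsum) h1.summable).trans ?_
    · rw [pow_add]
      have := mul_le_mul_of_nonneg_right (hAB (j + (m₀ + 1)))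
        (by positivity : (0 : ℝ) ≤ (1 / 2) ^ j * (1 / 2) ^ (m₀ + 1))
      linarith
    · rw [h1.tsum_eq, pow_succ]
      have h2 : (1 / 2 : ℝ) ^ m₀ * (B * S) ≤ 1 / (4 * B) * (B * S) := by gcongr
      have h3 : 1 / (4 * B) * (B * S) = S / 4 := by field_simp
      linarith
  have hhead : ∑ j ∈ Finset.range (m₀ + 1), A j * (1 / 2 : ℝ) ^ j ≤ A k * 2 := by
    calc ∑ j ∈ Finset.range (m₀ + 1), A j * (1 / 2 : ℝ) ^ j
        ≤ ∑ j ∈ Finset.range (m₀ + 1), A k * (1 / 2 : ℝ) ^ j := by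
          refine Finset.sum_le_sum fun j hj => ?_
          have := hmax j hj
          gcongr
      _ = A k * ∑ j ∈ Finset.range (m₀ + 1), (1 / 2 : ℝ) ^ j := by rw [Finset.mul_sum]
      _ ≤ A k * 2 := by
          have := sum_geometric_two_le (m₀ + 1)
          have := hA k
          gcongr
  have hS4 : S ≤ 4 * A k := by linarith
  by_cases hm : m < max m₀ m₁
  · exact ⟨m, hm.le, le_rfl⟩
  · have hmm : m₁ ≤ m := (le_max_right _ _).trans (not_lt.1 hm)
    refine ⟨k, (Nat.lt_succ_iff.1 (Finset.mem_range.1 hk)).trans (le_max_left _ _), ?_⟩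
    have hRm : 4 * B ≤ R ^ m := hm₁.le.trans (pow_le_pow_right₀ hR.le hmm)
    have h1 : A m * (4 * B) ≤ A k * (4 * B) := by
      calc A m * (4 * B) ≤ A m * R ^ m := by have := hA m; gcongr
        _ ≤ B * S := h m
        _ ≤ B * (4 * A k) := by gcongr
        _ = _ := by ring
    exact le_of_mul_le_mul_right h1 (by positivity)

/-- Pigeonhole: among `N + 1` well separated reals, one is far from the image of any set with at
most `N` elements. -/
lemma exists_far_from_image {Z : Set ℂ} {N : ℕ} (hZ : ∀ A : Finset ℂ, (∀ a ∈ A, a ∈ Z) → A.card ≤ N)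
    (q : ℂ → ℝ) (u : ℝ) {ε : ℝ} (hε : 0 < ε) :
    ∃ i ≤ N, ∀ a ∈ Z, ε < |u + 3 * ε * i - q a| := by
  by_contra! hcon
  have hcon' : ∀ i : Fin (N + 1), ∃ a ∈ Z, |u + 3 * ε * (i : ℕ) - q a| ≤ ε :=
    fun i => hcon i (Nat.lt_succ_iff.1 i.2)
  choose a ha hle using hcon'
  have hinj : Function.Injective a := by
    intro i j hij
    have h1 := hle i
    have h2 := hle j
    rw [← hij] at h2
    rw [abs_le] at h1 h2
    have h3 : (i : ℝ) - j < 1 := by nlinarith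
    have h4 : (j : ℝ) - i < 1 := by nlinarith
    have h5 : (i : ℕ) < j + 1 := by exact_mod_cast (by linarith : (i : ℝ) < j + 1)
    have h6 : (j : ℕ) < i + 1 := by exact_mod_cast (by linarith : (j : ℝ) < i + 1)
    exact Fin.ext (by omega)
  have := hZ (Finset.univ.map ⟨a, hinj⟩) (fun c hc => by
    obtain ⟨i, -, rfl⟩ := Finset.mem_map.1 hc
    exact ha i)
  simp at this

/-- The jet `(f, …, f⁽ᵖ⁻¹⁾)` together with an auxiliary function. -/
def jet (p : ℕ) (f ψ : ℂ → ℂ) (s : ℂ) : (Fin p → ℂ) × ℂ :=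
  (fun k => iteratedDeriv k f s, ψ s)

lemma norm_iteratedDeriv_le_jet {p k : ℕ} (hk : k < p) (f ψ : ℂ → ℂ) (s : ℂ) :
    ‖iteratedDeriv k f s‖ ≤ ‖jet p f ψ s‖ :=
  (norm_le_pi_norm (jet p f ψ s).1 ⟨k, hk⟩).trans (norm_fst_le _)

lemma norm_le_jet (p : ℕ) (f ψ : ℂ → ℂ) (s : ℂ) : ‖ψ s‖ ≤ ‖jet p f ψ s‖ :=
  norm_snd_le (jet p f ψ s)

/-- The differential inequalities satisfied by a solution `f` of the scaled equation away from the
zeros of its leading coefficient; `ψ` is the quotient of the right-hand side by that coefficient. -/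
structure OdeBound (p : ℕ) (T K : ℝ) (f ψ : ℂ → ℂ) (s : ℂ) : Prop where
  differentiableAt : DifferentiableAt ℂ ψ s
  deriv_le : ‖deriv ψ s‖ ≤ K * ‖ψ s‖
  top_le : ‖iteratedDeriv p f s‖ ≤ ‖ψ s‖ + T * ∑ k ∈ Finset.range p, ‖iteratedDeriv k f s‖
  quot_le : ‖ψ s‖ ≤ T * ∑ k ∈ Finset.range (p + 1), ‖iteratedDeriv k f s‖

namespace OdeBound

variable {p : ℕ} {T K : ℝ} {f ψ : ℂ → ℂ} {s : ℂ}

lemma norm_top_le (h : OdeBound p T K f ψ s) (hT : 0 ≤ T) :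
    ‖iteratedDeriv p f s‖ ≤ (1 + p * T) * ‖jet p f ψ s‖ := by
  have h1 : ∑ k ∈ Finset.range p, ‖iteratedDeriv k f s‖ ≤ p * ‖jet p f ψ s‖ := by
    refine (Finset.sum_le_card_nsmul _ _ _ fun k hk =>
      norm_iteratedDeriv_le_jet (Finset.mem_range.1 hk) f ψ s).trans ?_
    simp
  calc _ ≤ _ := h.top_le
    _ ≤ ‖jet p f ψ s‖ + T * (p * ‖jet p f ψ s‖) := by
        gcongr
        exact norm_le_jet p f ψ s
    _ = _ := by ring

lemma norm_iteratedDeriv_le (h : OdeBound p T K f ψ s) (hT : 0 ≤ T) {k : ℕ} (hk : k ≤ p) :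
    ‖iteratedDeriv k f s‖ ≤ (1 + p * T) * ‖jet p f ψ s‖ := by
  rcases hk.lt_or_eq with hk | rfl
  · refine (norm_iteratedDeriv_le_jet hk f ψ s).trans (le_mul_of_one_le_left (norm_nonneg _) ?_)
    have : 0 ≤ p * T := by positivity
    linarith
  · exact h.norm_top_le hT

lemma norm_jet_le (h : OdeBound p T K f ψ s) (hT : 1 ≤ T) :
    ‖jet p f ψ s‖ ≤ T * ∑ k ∈ Finset.range (p + 1), ‖iteratedDeriv k f s‖ := by
  have hs : 0 ≤ ∑ k ∈ Finset.range (p + 1), ‖iteratedDeriv k f s‖ :=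
    Finset.sum_nonneg fun _ _ => norm_nonneg _
  refine norm_prod_le_iff.2 ⟨(pi_norm_le_iff_of_nonneg (by positivity)).2 fun k => ?_, h.quot_le⟩
  refine le_trans ?_ (le_mul_of_one_le_left hs hT)
  exact Finset.single_le_sum (f := fun k => ‖iteratedDeriv k f s‖) (fun _ _ => norm_nonneg _)
    (Finset.mem_range.2 (by omega))

end OdeBound

lemma hasDerivAt_iteratedDeriv {f : ℂ → ℂ} {U : Set ℂ} (hU : IsOpen U)
    (hf : DifferentiableOn ℂ f U) (k : ℕ) {s : ℂ} (hs : s ∈ U) :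
    HasDerivAt (iteratedDeriv k f) (iteratedDeriv (k + 1) f s) s := by
  rw [iteratedDeriv_succ]
  have h := (hf.analyticAt (hU.mem_nhds hs)).iterated_deriv k
  rw [← iteratedDeriv_eq_iterate] at h
  exact h.differentiableAt.hasDerivAt

/-- Gronwall's inequality for the jet along a path. -/
lemma norm_jet_path_le {p : ℕ} {T K V ℓ : ℝ} (hT : 0 ≤ T) (hK : 0 ≤ K)
    {f ψ : ℂ → ℂ} {U : Set ℂ} (hU : IsOpen U) (hf : DifferentiableOn ℂ f U) {γ γ' : ℝ → ℂ}
    (hγ : ∀ τ, HasDerivAt γ (γ' τ) τ) (hV : ∀ τ, ‖γ' τ‖ ≤ V) (hℓ : 0 ≤ ℓ)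
    (hmem : ∀ τ ∈ Icc 0 ℓ, γ τ ∈ U) (hode : ∀ τ ∈ Icc 0 ℓ, OdeBound p T K f ψ (γ τ)) :
    ‖jet p f ψ (γ ℓ)‖ ≤ ‖jet p f ψ (γ 0)‖ * Real.exp (V * (1 + p * T + K) * ℓ) := by
  have hV0 : 0 ≤ V := (norm_nonneg _).trans (hV 0)
  have hpT : 0 ≤ p * T := by positivity
  set Y' : ℝ → (Fin p → ℂ) × ℂ := fun τ =>
    (fun k => γ' τ • iteratedDeriv (k + 1) f (γ τ), γ' τ • deriv ψ (γ τ)) with hY'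
  have hderiv : ∀ τ ∈ Icc 0 ℓ, HasDerivAt (fun τ => jet p f ψ (γ τ)) (Y' τ) τ := by
    intro τ hτ
    refine HasDerivAt.prodMk (hasDerivAt_pi.2 fun k => ?_) ?_
    · exact (hasDerivAt_iteratedDeriv hU hf k (hmem τ hτ)).scomp τ (hγ τ)
    · exact (hode τ hτ).differentiableAt.hasDerivAt.scomp τ (hγ τ)
  have hbound : ∀ τ ∈ Icc 0 ℓ, ‖Y' τ‖ ≤ V * (1 + p * T + K) * ‖jet p f ψ (γ τ)‖ + 0 := by
    intro τ hτ
    have ho := hode τ hτ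
    have hJ := norm_nonneg (jet p f ψ (γ τ))
    rw [add_zero, mul_assoc]
    refine norm_prod_le_iff.2 ⟨(pi_norm_le_iff_of_nonneg (by positivity)).2 fun k => ?_, ?_⟩
    · rw [hY', norm_smul]
      refine mul_le_mul (hV τ) ?_ (norm_nonneg _) hV0
      exact (ho.norm_iteratedDeriv_le hT (Nat.succ_le_of_lt k.2)).trans
        (mul_le_mul_of_nonneg_right (by linarith) hJ)
    · rw [hY', norm_smul]
      refine mul_le_mul (hV τ) (ho.deriv_le.trans ?_) (norm_nonneg _) hV0
      exact mul_le_mul (by linarith) (norm_le_jet p f ψ _) (norm_nonneg _) (by linarith)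
  have := norm_le_gronwallBound_of_norm_deriv_right_le (a := 0) (b := ℓ) (ε := 0)
    (fun τ hτ => (hderiv τ hτ).continuousAt.continuousWithinAt)
    (fun τ hτ => (hderiv τ (Ico_subset_Icc_self hτ)).hasDerivWithinAt) le_rfl
    (fun τ hτ => hbound τ (Ico_subset_Icc_self hτ)) ℓ ⟨hℓ, le_rfl⟩
  rwa [gronwallBound_ε0, sub_zero] at this

lemma tsum_bound_of_norm_le_half {f : ℂ → ℂ} (hf : DifferentiableOn ℂ f (ball 0 1)) {s : ℂ}
    (hs : ‖s‖ ≤ 1 / 2) : ‖f s‖ ≤ ∑' k, taylorAbs f k * (1 / 2) ^ k := by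
  have h1 := (Complex.hasSum_taylorSeries_on_ball hf
    (z := ((1 / 2 : ℝ) : ℂ)) (by rw [mem_ball_zero_iff, Complex.norm_real]; norm_num)).summable.norm
  have hn : ‖((1 / 2 : ℝ) : ℂ)‖ = 1 / 2 := by rw [Complex.norm_real]; norm_num
  simp_rw [norm_taylor_term, hn] at h1
  refine (Complex.hasSum_taylorSeries_on_ball hf (z := s)
    (by rw [mem_ball_zero_iff]; linarith)).norm_le_of_bounded h1.hasSum fun k => ?_
  rw [norm_taylor_term]
  have := taylorAbs_nonneg f k
  gcongr

/-- The bound for a solution on a circle, reached from a point near the origin along a vertical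
segment. -/
lemma norm_le_on_circle {p : ℕ} {T K β x R : ℝ} (hT : 1 ≤ T) (hK : 0 ≤ K) (hR : 1 < R)
    (hRβ : R < β) (hx0 : 0 ≤ x) (hx : x ≤ 1 / 4) {f ψ : ℂ → ℂ}
    (hf : DifferentiableOn ℂ f (ball 0 β))
    (hode : ∀ s : ℂ, ‖s‖ ≤ R → s.re = x ∨ ‖s‖ = R → OdeBound p T K f ψ s)
    {s : ℂ} (hs : ‖s‖ = R) :
    ‖f s‖ ≤ (1 + p * T) * Real.exp (β * Real.pi * (1 + p * T + K)) *
      Real.exp ((1 + p * T + K) * β) *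
      (T * ∑ k ∈ Finset.range (p + 1), (k ! : ℝ) * 4 ^ k) * ∑' k, taylorAbs f k * (1 / 2) ^ k := by
  have hT0 : 0 ≤ T := by linarith
  have hR0 : 0 < R := by linarith
  have hsub : ∀ w : ℂ, ‖w‖ ≤ R → w ∈ ball (0 : ℂ) β := fun w hw => by
    rw [mem_ball_zero_iff]; linarith
  set D := 1 + p * T + K with hD
  have hD0 : 0 ≤ D := by positivity
  set y := √(R ^ 2 - x ^ 2) with hy
  have hy2 : y ^ 2 = R ^ 2 - x ^ 2 := Real.sq_sqrt (by nlinarith)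
  have hy0 : 0 ≤ y := Real.sqrt_nonneg _
  have hyβ : y ≤ β := by nlinarith
  have hline : ∀ τ : ℝ, 0 ≤ τ → τ ≤ y → ‖(x : ℂ) + τ * Complex.I‖ ≤ R := by
    intro τ h1 h2
    rw [Complex.norm_add_mul_I]
    exact Real.sqrt_le_iff.2 ⟨hR0.le, by nlinarith⟩
  set w : ℂ := x + y * Complex.I with hw
  have hwR : ‖w‖ = R := by
    rw [hw, Complex.norm_add_mul_I, hy2, add_sub_cancel, Real.sqrt_sq hR0.le]
  have hw0 : w ≠ 0 := norm_pos_iff.1 (hwR ▸ hR0)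
  have hseg := norm_jet_path_le (p := p) (V := 1) hT0 hK isOpen_ball hf
    (γ := fun τ : ℝ => (x : ℂ) + τ * Complex.I) (γ' := fun _ => Complex.I)
    (fun τ => by
      simpa using ((Complex.ofRealCLM.hasDerivAt (x := τ)).mul_const Complex.I).const_add (x : ℂ))
    (fun τ => by simp) hy0 (fun τ hτ => hsub _ (hline τ hτ.1 hτ.2))
    (fun τ hτ => hode _ (hline τ hτ.1 hτ.2) (Or.inl (by simp)))
  set θ := (s / w).arg with hθ
  have hcirc : ∀ τ : ℝ, ‖w * Complex.exp (τ * (θ * Complex.I))‖ = R := by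
    intro τ
    rw [← mul_assoc, ← Complex.ofReal_mul, norm_mul, Complex.norm_exp_ofReal_mul_I, hwR, mul_one]
  have hend : w * Complex.exp ((1 : ℝ) * (θ * Complex.I)) = s := by
    have h1 : ‖s / w‖ = 1 := by rw [norm_div, hs, hwR, div_self hR0.ne']
    have h2 := Complex.norm_mul_exp_arg_mul_I (s / w)
    rw [h1, Complex.ofReal_one, one_mul] at h2
    rw [Complex.ofReal_one, one_mul, hθ, h2, mul_div_cancel₀ _ hw0]
  have harc := norm_jet_path_le (p := p) (V := β * Real.pi) (ℓ := 1) hT0 hK isOpen_ball hf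
    (γ := fun τ : ℝ => w * Complex.exp (τ * (θ * Complex.I)))
    (γ' := fun τ => w * (Complex.exp (τ * (θ * Complex.I)) * (θ * Complex.I)))
    (fun τ => by
      have h1 : HasDerivAt (fun τ : ℝ => (τ : ℂ) * (θ * Complex.I)) (θ * Complex.I) τ := by
        simpa using (Complex.ofRealCLM.hasDerivAt (x := τ)).mul_const (θ * Complex.I : ℂ)
      exact h1.cexp.const_mul w)
    (fun τ => by
      rw [← mul_assoc, norm_mul, hcirc, norm_mul, Complex.norm_I, mul_one, Complex.norm_real]
      exact mul_le_mul hRβ.le (Complex.abs_arg_le_pi _) (norm_nonneg _) (by linarith))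
    zero_le_one (fun τ _ => hsub _ (hcirc τ).le)
    (fun τ _ => hode _ (hcirc τ).le (Or.inr (hcirc τ)))
  simp only [hend, Complex.ofReal_zero, zero_mul, Complex.exp_zero, mul_one, ← hD] at harc
  simp only [← hw, Complex.ofReal_zero, zero_mul, add_zero, one_mul, ← hD] at hseg
  set S := ∑' k, taylorAbs f k * (1 / 2) ^ k with hS
  have hxode : OdeBound p T K f ψ x := hode x (by
    rw [Complex.norm_real, Real.norm_of_nonneg hx0]; linarith) (Or.inl (by simp))
  have hcauchy : ∀ k, ‖iteratedDeriv k f x‖ ≤ (k ! : ℝ) * 4 ^ k * S := by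
    intro k
    have hcb : closedBall (x : ℂ) (1 / 4) ⊆ closedBall 0 (1 / 2) := by
      refine closedBall_subset_closedBall' ?_
      rw [dist_zero_right, Complex.norm_real, Real.norm_of_nonneg hx0]; linarith
    have hd : DiffContOnCl ℂ f (ball (x : ℂ) (1 / 4)) := by
      refine DifferentiableOn.diffContOnCl (hf.mono ?_)
      rw [closure_ball _ (by norm_num)]
      exact hcb.trans (closedBall_subset_ball (by linarith))
    refine (Complex.norm_iteratedDeriv_le_of_forall_mem_sphere_norm_le k (by norm_num) hd (C := S)
      fun v hv => tsum_bound_of_norm_le_half (hf.mono (ball_subset_ball (by linarith)))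
        (mem_closedBall_zero_iff.1 (hcb (sphere_subset_closedBall hv)))).trans (le_of_eq ?_)
    rw [one_div (4 : ℝ), inv_pow, div_inv_eq_mul]
    ring
  have hjet : ‖jet p f ψ x‖ ≤ T * (∑ k ∈ Finset.range (p + 1), (k ! : ℝ) * 4 ^ k) * S := by
    refine (hxode.norm_jet_le hT).trans ?_
    rw [mul_assoc, Finset.sum_mul]
    gcongr with k
    exact hcauchy k
  have hexp : Real.exp (D * y) ≤ Real.exp (D * β) := by gcongr
  have hfs : ‖f s‖ ≤ (1 + p * T) * ‖jet p f ψ s‖ := by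
    simpa using (hode s hs.le (Or.inr hs)).norm_iteratedDeriv_le hT0 (Nat.zero_le p)
  have hjx := (norm_nonneg _).trans hjet
  calc ‖f s‖ ≤ (1 + p * T) * ‖jet p f ψ s‖ := hfs
    _ ≤ (1 + p * T) * ((‖jet p f ψ x‖ * Real.exp (D * y)) * Real.exp (β * Real.pi * D)) := by
        gcongr
        exact harc.trans (by gcongr)
    _ ≤ (1 + p * T) * ((T * (∑ k ∈ Finset.range (p + 1), (k ! : ℝ) * 4 ^ k) * S
          * Real.exp (D * β)) * Real.exp (β * Real.pi * D)) := by gcongr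
    _ = _ := by ring

/-- Solutions of a scaled linear equation whose singularities are confined to few small discs have
their Taylor coefficients dominated by an initial segment of uniform length. -/
lemma exists_index_of_odeBound {β : ℝ} (hβ : 1 < β) (N : ℕ) :
    ∃ ε : ℝ, 0 < ε ∧ ∃ ρ : ℝ, 0 ≤ ρ ∧ ρ + ε ≤ β ∧ ∀ (p : ℕ) (T K : ℝ), 1 ≤ T → 0 ≤ K → ∃ m₀ : ℕ,
      ∀ (f ψ : ℂ → ℂ) (Z : Set ℂ), DifferentiableOn ℂ f (ball 0 β) →
        (∀ A : Finset ℂ, (∀ a ∈ A, a ∈ Z) → A.card ≤ N) →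
        (∀ s : ℂ, ‖s‖ ≤ ρ → (∀ a ∈ Z, ε < ‖s - a‖) → OdeBound p T K f ψ s) →
        ∀ m, ∃ k ≤ m₀, taylorAbs f m ≤ taylorAbs f k := by
  set δ : ℝ := min (1 / 4) ((β - 1) / 3) with hδ
  have hδ0 : 0 < δ := lt_min (by norm_num) (by linarith)
  have hδ1 : δ ≤ 1 / 4 := min_le_left _ _
  have hδ2 : δ ≤ (β - 1) / 3 := min_le_right _ _
  set ε : ℝ := δ / (3 * (N + 1)) with hε
  have hε0 : 0 < ε := by positivity
  have hεmul : 3 * ε * (N + 1) = δ := by rw [hε]; field_simp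
  have hεδ : ε ≤ δ := by
    rw [← hεmul]; nlinarith [(Nat.cast_nonneg N : (0 : ℝ) ≤ N)]
  have hstep : ∀ i : ℕ, i ≤ N → 3 * ε * i ≤ δ := by
    intro i hi
    rw [← hεmul]
    have : (i : ℝ) ≤ N := by exact_mod_cast hi
    nlinarith
  refine ⟨ε, hε0, 1 + 2 * (β - 1) / 3, by linarith, by linarith, fun p T K hT hK => ?_⟩
  have hT0 : 0 < T := by linarith
  set B := (1 + p * T) * Real.exp (β * Real.pi * (1 + p * T + K)) *
      Real.exp ((1 + p * T + K) * β) *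
      (T * ∑ k ∈ Finset.range (p + 1), (k ! : ℝ) * 4 ^ k) with hB
  have hB0 : 0 < B := by
    have : 0 < ∑ k ∈ Finset.range (p + 1), (k ! : ℝ) * 4 ^ k :=
      Finset.sum_pos (fun k _ => by positivity) ⟨0, by simp⟩
    positivity
  have hR₁ : 1 < 1 + (β - 1) / 3 := by linarith
  obtain ⟨m₀, hm₀⟩ := exists_dominating_initial_segment hB0 hR₁
  refine ⟨m₀, fun f ψ Z hf hZ hode => hm₀ _ (taylorAbs_nonneg f) fun m => ?_⟩
  obtain ⟨i, hi, hix⟩ := exists_far_from_image hZ Complex.re 0 hε0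
  obtain ⟨j, hj, hjR⟩ := exists_far_from_image hZ norm (1 + (β - 1) / 3) hε0
  set x : ℝ := 0 + 3 * ε * i with hx
  set R : ℝ := 1 + (β - 1) / 3 + 3 * ε * j with hR
  have hx0 : 0 ≤ x := by positivity
  have hx4 : x ≤ 1 / 4 := by linarith [hstep i hi]
  have hj0 : 0 ≤ 3 * ε * j := by positivity
  have hRle : R ≤ 1 + 2 * (β - 1) / 3 := by linarith [hstep j hj]
  have hcircle : ∀ s ∈ sphere (0 : ℂ) R, ‖f s‖ ≤ B * ∑' k, taylorAbs f k * (1 / 2) ^ k := by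
    intro s hs
    refine norm_le_on_circle hT hK (by linarith) (by linarith) hx0 hx4 hf (ψ := ψ) ?_
      (mem_sphere_zero_iff_norm.1 hs)
    intro v hv hv'
    refine hode v (hv.trans hRle) fun a ha => ?_
    rcases hv' with hv' | hv'
    · refine (hix a ha).trans_le ?_
      rw [← hv', ← Complex.sub_re]
      exact Complex.abs_re_le_norm _
    · refine (hjR a ha).trans_le ?_
      rw [← hv']
      exact abs_norm_sub_norm_le v a
  have hd : DiffContOnCl ℂ f (ball 0 R) := by
    refine DifferentiableOn.diffContOnCl (hf.mono ?_)
    rw [closure_ball _ (by linarith)]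
    exact closedBall_subset_ball (by linarith)
  have hc := Complex.norm_iteratedDeriv_le_of_forall_mem_sphere_norm_le m (by linarith) hd hcircle
  calc taylorAbs f m * (1 + (β - 1) / 3) ^ m ≤ taylorAbs f m * R ^ m := by
        have := taylorAbs_nonneg f m
        gcongr
        linarith
    _ ≤ _ := by
        rw [taylorAbs, div_mul_eq_mul_div, div_le_iff₀ (by positivity)]
        rw [le_div_iff₀ (by positivity)] at hc
        linarith

lemma norm_deriv_div_le {u v : ℂ → ℂ} {s : ℂ} {K₁ K₂ : ℝ} (hu : DifferentiableAt ℂ u s)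
    (hv : DifferentiableAt ℂ v s) (hv0 : v s ≠ 0) (h1 : ‖deriv u s‖ ≤ K₁ * ‖u s‖)
    (h2 : ‖deriv v s‖ ≤ K₂ * ‖v s‖) :
    ‖deriv (fun s => u s / v s) s‖ ≤ (K₁ + K₂) * ‖u s / v s‖ := by
  have hv0' : 0 < ‖v s‖ := norm_pos_iff.2 hv0
  rw [(hu.hasDerivAt.fun_div hv.hasDerivAt hv0).deriv, norm_div, norm_div, norm_pow,
    div_le_iff₀ (by positivity)]
  calc ‖deriv u s * v s - u s * deriv v s‖ ≤ ‖deriv u s‖ * ‖v s‖ + ‖u s‖ * ‖deriv v s‖ := by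
        refine (norm_sub_le _ _).trans ?_
        rw [norm_mul, norm_mul]
    _ ≤ K₁ * ‖u s‖ * ‖v s‖ + ‖u s‖ * (K₂ * ‖v s‖) := by gcongr
    _ = (K₁ + K₂) * (‖u s‖ / ‖v s‖) * ‖v s‖ ^ 2 := by field_simp

lemma bounds_of_monic_combination {p : ℕ} {q : Fin (p + 1) → ℂ} {d : ℕ → ℂ} {T : ℝ} {ψ : ℂ}
    (hT : 1 ≤ T) (hq0 : q 0 = 1) (hq : ∀ j, ‖q j‖ ≤ T)
    (hψ : ∑ j : Fin (p + 1), q j * d (p - (j : ℕ)) = ψ) :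
    ‖d p‖ ≤ ‖ψ‖ + T * ∑ k ∈ Finset.range p, ‖d k‖ ∧
      ‖ψ‖ ≤ T * ∑ k ∈ Finset.range (p + 1), ‖d k‖ := by
  rw [Fin.sum_univ_succ, hq0, one_mul] at hψ
  simp only [Fin.val_zero, Nat.sub_zero, Fin.val_succ] at hψ
  have hR : ‖∑ i : Fin p, q i.succ * d (p - (i + 1))‖ ≤ T * ∑ k ∈ Finset.range p, ‖d k‖ := by
    rw [← Finset.sum_range_reflect, ← Fin.sum_univ_eq_sum_range (fun k => ‖d (p - 1 - k)‖),
      Finset.mul_sum]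
    refine norm_sum_le_of_le _ fun i _ => ?_
    rw [norm_mul, show p - 1 - (i : ℕ) = p - (i + 1) by omega]
    exact mul_le_mul_of_nonneg_right (hq _) (norm_nonneg _)
  constructor
  · rw [← hψ]
    have := norm_sub_le (d p + ∑ i : Fin p, q i.succ * d (p - (i + 1)))
      (∑ i : Fin p, q i.succ * d (p - (i + 1)))
    rw [add_sub_cancel_right] at this
    linarith
  · rw [← hψ, Finset.sum_range_succ, mul_add, add_comm (T * _)]
    have hd := le_mul_of_one_le_left (norm_nonneg (d p)) hT
    exact (norm_add_le _ _).trans (by linarith)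

lemma continuousOn_normalizedDeriv {b : Cn n} {β : ℝ} {L : Cn n → ℝ} (hL : ClassQ b β L)
    {F : Cn n → ℂ} (hF : AnalyticOnNhd ℂ F (unitBall n)) (k : ℕ) :
    ContinuousOn (normalizedDeriv L b F k) (unitBall n) := by
  refine ContinuousOn.div (analyticOnNhd_dirDeriv hF k).continuousOn.norm
    (continuousOn_const.mul (hL.continuousOn.pow k)) fun z hz => ?_
  have := hL.pos z hz
  positivity

/-- The inequality defining bounded index extends from a dense subset to the whole ball. -/
lemma le_sup'_normalizedDeriv_of_mem_closure {b : Cn n} {β : ℝ} {L : Cn n → ℝ}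
    (hL : ClassQ b β L) {F : Cn n → ℂ} (hF : AnalyticOnNhd ℂ F (unitBall n)) {m m₀ : ℕ}
    {D : Set (Cn n)} (hD : D ⊆ unitBall n)
    (h : ∀ z ∈ D, normalizedDeriv L b F m z ≤
      (Finset.range (m₀ + 1)).sup' Finset.nonempty_range_add_one
        (fun k => normalizedDeriv L b F k z))
    {z : Cn n} (hz : z ∈ unitBall n) (hzD : z ∈ closure D) :
    normalizedDeriv L b F m z ≤
      (Finset.range (m₀ + 1)).sup' Finset.nonempty_range_add_one
        (fun k => normalizedDeriv L b F k z) := by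
  have hc := fun k => (continuousOn_normalizedDeriv hL hF k z hz).mono hD
  refine ContinuousWithinAt.closure_le hzD (hc m) ?_ h
  exact ContinuousWithinAt.finset_sup'_apply _ fun k _ => hc k

lemma mem_closure_ne_zero {b : Cn n} {L : Cn n → ℝ} {r : ℝ} {G : Cn n → ℂ}
    (hG : AnalyticOnNhd ℂ G (unitBall n)) (hne : (unitBall n \ zeroNhd L b G r).Nonempty)
    {z : Cn n} (hz : z ∈ unitBall n) : z ∈ closure {w | w ∈ unitBall n ∧ G w ≠ 0} := by
  by_contra hcon
  obtain ⟨w, hw, hwG⟩ := hne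
  have hev : G =ᶠ[𝓝 z] 0 := by
    filter_upwards [isClosed_closure.isOpen_compl.mem_nhds hcon, isOpen_ball.mem_nhds hz]
      with v hv hv'
    by_contra hGv
    exact hv (subset_closure ⟨hv', hGv⟩)
  have h0 := hG.eqOn_zero_of_preconnected_of_eventuallyEq_zero
    (convex_ball (0 : Cn n) 1).isPreconnected hz hev
  refine hwG (mem_iUnion₂.2 ⟨w, hw, Or.inl ⟨fun t ht => h0 ht, 0, ?_, by simp⟩⟩)
  simpa [sliceParam] using hw

/-- A point near `s` on the slice through `z`, seen from `w = z + (s / L z) b`. -/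
lemma exists_slice_param {b z : Cn n} {L : Cn n → ℝ} {s : ℂ} {lam ε : ℝ} (hlam : 0 < lam)
    (hz : 0 < L z) (hw : 0 < L (z + (s / (L z : ℂ)) • b))
    (hc : L z ≤ lam * L (z + (s / (L z : ℂ)) • b)) {σ : ℂ} (hσ : ‖σ‖ ≤ ε / lam) :
    ∃ a : ℂ, ‖s - a‖ ≤ ε ∧ ∀ F : Cn n → ℂ,
      sliceFun F b (z + (s / (L z : ℂ)) • b) (L (z + (s / (L z : ℂ)) • b)) σ
        = sliceFun F b z (L z) a := by
  set w := z + (s / (L z : ℂ)) • b with hwdef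
  refine ⟨s + σ * (L z / L w : ℝ), ?_, fun F => ?_⟩
  · have hq : L z / L w ≤ lam := by rwa [div_le_iff₀ hw]
    rw [sub_add_cancel_left, norm_neg, norm_mul, Complex.norm_real,
      Real.norm_of_nonneg (by positivity)]
    calc ‖σ‖ * (L z / L w) ≤ ε / lam * lam :=
          mul_le_mul hσ hq (by positivity) ((norm_nonneg _).trans hσ)
      _ = ε := by field_simp
  · have hz' : (L z : ℂ) ≠ 0 := by exact_mod_cast hz.ne'
    have hw' : (L w : ℂ) ≠ 0 := by exact_mod_cast hw.ne'
    rw [sliceFun, sliceFun, ← slice_rebase b z hw.ne' s]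
    congr 4
    push_cast
    field_simp
    ring

lemma norm_deriv_sliceFun_le {b z : Cn n} {L : Cn n → ℝ} {s : ℂ} {lam K : ℝ} (hK : 0 ≤ K)
    (hz : 0 < L z) {F : Cn n → ℂ} (hF : AnalyticOnNhd ℂ F (unitBall n))
    (hw : z + (s / (L z : ℂ)) • b ∈ unitBall n)
    (hc : L (z + (s / (L z : ℂ)) • b) ≤ lam * L z)
    (h : ‖dirDeriv b 1 F (z + (s / (L z : ℂ)) • b)‖
      ≤ K * L (z + (s / (L z : ℂ)) • b) * ‖F (z + (s / (L z : ℂ)) • b)‖) :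
    ‖deriv (sliceFun F b z (L z)) s‖ ≤ K * lam * ‖sliceFun F b z (L z) s‖ := by
  have hd : deriv (sliceFun F b z (L z)) s = dirDeriv b 1 F (z + (s / (L z : ℂ)) • b) / L z :=
    (hasDerivAt_dirDeriv_slice hF 0 hw).deriv
  rw [hd, norm_div, Complex.norm_real, Real.norm_of_nonneg hz.le, div_le_iff₀ hz]
  calc _ ≤ _ := h
    _ ≤ K * (lam * L z) * ‖F (z + (s / (L z : ℂ)) • b)‖ := by gcongr
    _ = K * lam * ‖sliceFun F b z (L z) s‖ * L z := by rw [sliceFun]; ring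

/-- The zeros of the leading coefficient and of the right-hand side on a slice, the latter only if
the right-hand side does not vanish identically there. -/
def singularParams (b z : Cn n) (ℓ β : ℝ) (G H : Cn n → ℂ) : Set ℂ :=
  {a | ‖a‖ ≤ β ∧ (sliceFun G b z ℓ a = 0 ∨
    ((∃ t : ℂ, z + t • b ∈ unitBall n ∧ H (z + t • b) ≠ 0) ∧ sliceFun H b z ℓ a = 0))}

lemma card_le_of_subset_singularParams {b z : Cn n} {ℓ β : ℝ} {G H : Cn n → ℂ} {N₁ N₂ : ℕ}
    (h1 : ∀ A : Finset ℂ, (∀ a ∈ A, ‖a‖ ≤ β ∧ sliceFun G b z ℓ a = 0) → A.card ≤ N₁)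
    (h2 : (∃ t : ℂ, z + t • b ∈ unitBall n ∧ H (z + t • b) ≠ 0) →
      ∀ A : Finset ℂ, (∀ a ∈ A, ‖a‖ ≤ β ∧ sliceFun H b z ℓ a = 0) → A.card ≤ N₂)
    (A : Finset ℂ) (hA : ∀ a ∈ A, a ∈ singularParams b z ℓ β G H) : A.card ≤ N₁ + N₂ := by
  classical
  rw [← Finset.card_filter_add_card_filter_not (s := A) fun a => sliceFun G b z ℓ a = 0]
  refine add_le_add (h1 _ fun a ha => ?_) ?_
  · obtain ⟨ha1, ha2⟩ := Finset.mem_filter.1 ha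
    exact ⟨(hA a ha1).1, ha2⟩
  · have hmem : ∀ a ∈ A.filter fun a => ¬ sliceFun G b z ℓ a = 0,
        (∃ t : ℂ, z + t • b ∈ unitBall n ∧ H (z + t • b) ≠ 0) ∧
          ‖a‖ ≤ β ∧ sliceFun H b z ℓ a = 0 := by
      intro a ha
      obtain ⟨ha1, ha2⟩ := Finset.mem_filter.1 ha
      obtain ⟨hn, h | h⟩ := hA a ha1
      · exact absurd h ha2
      · exact ⟨h.1, hn, h.2⟩
    rcases (A.filter fun a => ¬ sliceFun G b z ℓ a = 0).eq_empty_or_nonempty with he | ⟨a, ha⟩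
    · simp [he]
    · exact h2 (hmem a ha).1 _ fun c hc => (hmem c hc).2

lemma sum_scaled_eq {b : Cn n} {p : ℕ} {g : Fin (p + 1) → Cn n → ℂ} {h F : Cn n → ℂ}
    (hF : AnalyticOnNhd ℂ F (unitBall n)) {z : Cn n} {ℓ : ℝ} (hℓ : ℓ ≠ 0) {s : ℂ}
    (hw : z + (s / (ℓ : ℂ)) • b ∈ unitBall n) (hg0 : sliceFun (g 0) b z ℓ s ≠ 0)
    (heq : ∑ j : Fin (p + 1), g j (z + (s / (ℓ : ℂ)) • b)
      * dirDeriv b (p - (j : ℕ)) F (z + (s / (ℓ : ℂ)) • b) = h (z + (s / (ℓ : ℂ)) • b)) :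
    ∑ j : Fin (p + 1), (sliceFun (g j) b z ℓ s / ((ℓ : ℂ) ^ (j : ℕ) * sliceFun (g 0) b z ℓ s))
      * iteratedDeriv (p - (j : ℕ)) (sliceFun F b z ℓ) s
        = sliceFun h b z ℓ s / ((ℓ : ℂ) ^ p * sliceFun (g 0) b z ℓ s) := by
  have hℓ' : (ℓ : ℂ) ≠ 0 := by exact_mod_cast hℓ
  rw [show sliceFun h b z ℓ s = h (z + (s / (ℓ : ℂ)) • b) from rfl, ← heq, Finset.sum_div]
  refine Finset.sum_congr rfl fun j _ => ?_
  rw [iteratedDeriv_sliceFun hF _ hw]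
  have hp : (ℓ : ℂ) ^ p = (ℓ : ℂ) ^ (j : ℕ) * (ℓ : ℂ) ^ (p - (j : ℕ)) := by
    rw [← pow_add, Nat.add_sub_cancel' (Nat.lt_succ_iff.1 j.2)]
  rw [hp]
  change g j (z + (s / (ℓ : ℂ)) • b) / _ * _ = _
  field_simp

/-- Analytic solutions of a linear equation in direction `b` whose coefficients have bounded index
and are controlled by the leading one away from its zeros are themselves of bounded index. -/
theorem isOfBoundedIndex_of_equation {b : Cn n} (hb : b ≠ 0) {β : ℝ} (hβ : 1 < β)
    {L : Cn n → ℝ} (hL : ClassQ b β L)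
    {p : ℕ} {g : Fin (p + 1) → Cn n → ℂ} {h : Cn n → ℂ}
    (hg : ∀ j, IsOfBoundedIndex L b (g j))
    (hh : IsOfBoundedIndex L b h)
    (hne : (unitBall n \ zeroNhd L b (g 0) β).Nonempty)
    (hT : ∀ r : ℝ, 0 < r → r ≤ β → ∃ T : ℝ, 0 < T ∧
      ∀ z ∈ unitBall n \ zeroNhd L b (g 0) r,
        ∀ j : Fin (p + 1), 1 ≤ (j : ℕ) → ‖g j z‖ ≤ T * L z ^ (j : ℕ) * ‖g 0 z‖)
    {F : Cn n → ℂ} (hF : AnalyticOnNhd ℂ F (unitBall n))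
    (heq : ∀ z ∈ unitBall n,
      ∑ j : Fin (p + 1), g j z * dirDeriv b (p - (j : ℕ)) F z = h z) :
    IsOfBoundedIndex L b F := by
  obtain ⟨lam, hlam, hcomp⟩ := hL.exists_comparable hb hβ
  have hlam0 : 0 < lam := by linarith
  obtain ⟨N₁, hN₁⟩ := exists_card_zeros_le (hg 0) hL hb hβ
  obtain ⟨N₂, hN₂⟩ := exists_card_zeros_le hh hL hb hβ
  obtain ⟨ε, hε, ρ, hρ, hρε, hindex⟩ := exists_index_of_odeBound hβ (N₁ + N₂)
  have hεlam : 0 < ε / lam := by positivity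
  have hεβ : ε / lam / lam ≤ β := by
    rw [div_div]
    exact (div_le_self hε.le (one_le_mul_of_one_le_of_one_le hlam hlam)).trans (by linarith)
  obtain ⟨K₁, hK₁, hlog₁⟩ := exists_norm_dirDeriv_one_le (hg 0) hL hb hβ hεlam
  obtain ⟨K₂, hK₂, hlog₂⟩ := exists_norm_dirDeriv_one_le hh hL hb hβ hεlam
  obtain ⟨T, hT0, hTle⟩ := hT (ε / lam / lam) (by positivity) hεβ
  obtain ⟨m₀, hm₀⟩ := hindex p (max 1 (T * lam ^ p)) (K₂ * lam + K₁ * lam) (le_max_left _ _)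
    (by positivity)
  refine ⟨hF, m₀, fun m z hz => le_sup'_normalizedDeriv_of_mem_closure hL hF
    (D := {w | w ∈ unitBall n ∧ g 0 w ≠ 0}) (fun _ hw => hw.1)
    (fun z ⟨hz, hgz⟩ => ?_) hz (mem_closure_ne_zero (hg 0).1 hne hz)⟩
  have hLz := hL.pos z hz
  have hLzc : (L z : ℂ) ≠ 0 := by exact_mod_cast hLz.ne'
  have hode : ∀ s : ℂ, ‖s‖ ≤ ρ → (∀ a ∈ singularParams b z (L z) β (g 0) h, ε < ‖s - a‖) →
      OdeBound p (max 1 (T * lam ^ p)) (K₂ * lam + K₁ * lam) (sliceFun F b z (L z))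
        (fun s => sliceFun h b z (L z) s / ((L z : ℂ) ^ p * sliceFun (g 0) b z (L z) s)) s := by
    intro s hs hfar
    have hsβ : ‖s‖ ≤ β := by linarith
    have hw := hL.slice_mem_ball hb hz hsβ
    obtain ⟨hc₁, hc₂⟩ := hcomp z hz _ (hL.norm_div_le hz hsβ)
    have hLw := hL.pos _ hw
    have hparam := fun σ (hσ : ‖σ‖ ≤ ε / lam) => exists_slice_param hlam0 hLz hLw hc₂ hσ
    have hnorm : ∀ a : ℂ, ‖s - a‖ ≤ ε → ‖a‖ ≤ β := fun a ha => by
      have := norm_sub_norm_le a s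
      rw [norm_sub_rev] at this
      linarith
    have hne₁ : ∀ σ : ℂ, ‖σ‖ ≤ ε / lam → sliceFun (g 0) b (z + (s / (L z : ℂ)) • b)
        (L (z + (s / (L z : ℂ)) • b)) σ ≠ 0 := by
      intro σ hσ h0
      obtain ⟨a, ha, hFa⟩ := hparam σ hσ
      rw [hFa] at h0
      exact absurd (hfar a ⟨hnorm a ha, Or.inl h0⟩) (not_lt.2 ha)
    have hg0 : sliceFun (g 0) b z (L z) s ≠ 0 := by
      simpa [sliceFun] using hne₁ 0 (by rw [norm_zero]; positivity)
    have hd₁ := norm_deriv_sliceFun_le hK₁.le hLz (hg 0).1 hw hc₁ (hlog₁ _ hw hne₁)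
    have hd₂ : ‖deriv (sliceFun h b z (L z)) s‖
        ≤ K₂ * lam * ‖sliceFun h b z (L z) s‖ := by
      by_cases hnv : ∃ t : ℂ, z + t • b ∈ unitBall n ∧ h (z + t • b) ≠ 0
      · refine norm_deriv_sliceFun_le hK₂.le hLz hh.1 hw hc₁ (hlog₂ _ hw fun σ hσ h0 => ?_)
        obtain ⟨a, ha, hFa⟩ := hparam σ hσ
        rw [hFa] at h0
        exact absurd (hfar a ⟨hnorm a ha, Or.inr ⟨hnv, h0⟩⟩) (not_lt.2 ha)
      · push Not at hnv
        have hev : sliceFun h b z (L z) =ᶠ[nhds s] fun _ => 0 := by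
          filter_upwards [(continuous_slice b z (L z)).continuousAt.preimage_mem_nhds
            (Metric.isOpen_ball.mem_nhds hw)] with u hu using hnv _ hu
        rw [hev.deriv_eq, deriv_const, norm_zero]
        positivity
    have hdiff₁ := differentiableAt_sliceFun (hg 0).1 hw
    have hdiff₂ := differentiableAt_sliceFun hh.1 hw
    have hden : (L z : ℂ) ^ p * sliceFun (g 0) b z (L z) s ≠ 0 :=
      mul_ne_zero (pow_ne_zero _ hLzc) hg0
    have hnot : z + (s / (L z : ℂ)) • b ∉ zeroNhd L b (g 0) (ε / lam / lam) :=
      notMem_zeroNhd hL hcomp (by positivity) hεβ hlam hw fun σ hσ =>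
        hne₁ σ (by rwa [div_mul_cancel₀ _ hlam0.ne'] at hσ)
    have hcoef : ∀ j : Fin (p + 1), ‖sliceFun (g j) b z (L z) s /
        ((L z : ℂ) ^ (j : ℕ) * sliceFun (g 0) b z (L z) s)‖ ≤ max 1 (T * lam ^ p) := by
      intro j
      rcases Nat.eq_zero_or_pos (j : ℕ) with hj | hj
      · obtain rfl : j = 0 := Fin.ext hj
        simp [div_self hg0]
      · refine le_trans ?_ (le_max_right _ _)
        have hg0' : 0 < ‖sliceFun (g 0) b z (L z) s‖ := norm_pos_iff.2 hg0
        rw [norm_div, norm_mul, norm_pow, Complex.norm_real, Real.norm_of_nonneg hLz.le,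
          div_le_iff₀ (by positivity)]
        calc ‖sliceFun (g j) b z (L z) s‖
            ≤ T * L (z + (s / (L z : ℂ)) • b) ^ (j : ℕ) * ‖sliceFun (g 0) b z (L z) s‖ :=
              hTle _ ⟨hw, hnot⟩ j hj
          _ ≤ T * (lam * L z) ^ (j : ℕ) * ‖sliceFun (g 0) b z (L z) s‖ := by gcongr
          _ = T * lam ^ (j : ℕ) * (L z ^ (j : ℕ) * ‖sliceFun (g 0) b z (L z) s‖) := by
              rw [mul_pow]; ring
          _ ≤ T * lam ^ p * (L z ^ (j : ℕ) * ‖sliceFun (g 0) b z (L z) s‖) := by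
              gcongr
              omega
    obtain ⟨hb₁, hb₂⟩ := bounds_of_monic_combination
      (d := fun k => iteratedDeriv k (sliceFun F b z (L z)) s) (le_max_left _ _)
      (by simp [div_self hg0]) hcoef (sum_scaled_eq hF hLz.ne' hw hg0 (heq _ hw))
    refine ⟨hdiff₂.div (hdiff₁.const_mul _) hden,
      norm_deriv_div_le hdiff₂ (hdiff₁.const_mul _) hden hd₂ ?_, hb₁, hb₂⟩
    rw [deriv_const_mul_field, norm_mul, norm_mul, mul_left_comm]
    gcongr
  obtain ⟨k, hk, hle⟩ := hm₀ _ _ _ (hL.differentiableOn_sliceFun hb hF hz)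
    (card_le_of_subset_singularParams (hN₁ z hz ⟨0, by simpa using hz, by simpa using hgz⟩)
      (hN₂ z hz)) hode m
  rw [taylorAbs_sliceFun hF hz hLz, taylorAbs_sliceFun hF hz hLz] at hle
  exact hle.trans (Finset.le_sup' (fun k => normalizedDeriv L b F k z)
    (Finset.mem_range.2 (Nat.lt_succ_iff.2 hk)))

end LIndex

end

theorem theorem13 (n : ℕ) (b : LIndex.Cn n) (hb : b ≠ 0) (β : ℝ) (hβ : 1 < β)
    (L : LIndex.Cn n → ℝ) (hL : LIndex.ClassQ b β L)
    (p : ℕ) (g : Fin (p + 1) → LIndex.Cn n → ℂ) (h : LIndex.Cn n → ℂ)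
    (hg : ∀ j, LIndex.IsOfBoundedIndex L b (g j))
    (hh : LIndex.IsOfBoundedIndex L b h)
    (hne : (LIndex.unitBall n \ LIndex.zeroNhd L b (g 0) β).Nonempty)
    (hT : ∀ r : ℝ, 0 < r → r ≤ β → ∃ T : ℝ, 0 < T ∧
      ∀ z ∈ LIndex.unitBall n \ LIndex.zeroNhd L b (g 0) r,
        ∀ j : Fin (p + 1), 1 ≤ (j : ℕ) → ‖g j z‖ ≤ T * L z ^ (j : ℕ) * ‖g 0 z‖)
    (F : LIndex.Cn n → ℂ) (hF : AnalyticOnNhd ℂ F (LIndex.unitBall n))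
    (heq : ∀ z ∈ LIndex.unitBall n,
      ∑ j : Fin (p + 1), g j z * LIndex.dirDeriv b (p - (j : ℕ)) F z = h z) :
    LIndex.IsOfBoundedIndex L b F :=
  LIndex.isOfBoundedIndex_of_equation hb hβ hL hg hh hne hT hF heq
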